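/- Let $H=(V,F)$ be a finite hypergraph: $V$ is a finite set and $F$ a set of non-empty subsets of $V$. Write $d_i=|\{\alpha\in F: i\in\alpha\}|$. **Exponential families.** For a ($\sigma$-finite) measure space $(\mathcal X,\nu)$ and a measurable $\phi:\mathcal X\to\mathbb R^n$, put $\psi(\theta)=\log\int e^{\langle\theta,\phi\rangle}d\nu$ and $\Theta=\operatorname{int}\{\theta:\psi(\theta)<\infty\}$. The family consists of the distributions with density $p_\theta=e^{\langle\theta,\phi\rangle-\psi(\theta)}$ with respect to $\nu$, $\theta\in\Theta$. Put $\Lambda(\theta)=\mathbb E_{p_\theta}[\phi]$, $Y=\Lambda(\Theta)$ and $\varphi(\eta)=\sup_{\theta\in\Theta}(\langle\theta,\eta\rangle-\psi(\theta))$. **Inference family.** For each $i\in V$ let $\mathcal E_i$ be the exponential family on $(\mathcal X_i,\nu_i)$ with statistic $\phi_i:\mathcal X_i\to\mathbb R^{r_i}$, and for each $\alpha\in F$ let $\mathcal E_\alpha$ be the exponential family on $\prod_{i\in\alpha}\mathcal X_i$ with base measure $\prod_{i\in\alpha}\nu_i$ and statistic $\phi_\alpha=(\phi_{\langle\alpha\rangle},(\phi_i)_{i\in\alpha})$,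 where $\phi_{\langle\alpha\rangle}$ takes values in $\mathbb R^{s_\alpha}$. Assume that the Hessians of all the log partition functions $\psi_i$ and $\psi_\alpha$ are invertible at every point of $\Theta_i$ and $\Theta_\alpha$ respectively, and that for $i\in\alpha$ the marginal on $\mathcal X_i$ of every member of $\mathcal E_\alpha$ belongs to $\mathcal E_i$. **Bethe free energy.** Let $L$ be the set of $\eta=\{\eta_{\langle\alpha\rangle},\eta_i\}_{\alpha\in F,i\in V}$ with $\eta_i\in Y_i$ for all $i\in V$ and $\eta_\alpha:=(\eta_{\langle\alpha\rangle},(\eta_i)_{i\in\alpha})\in Y_\alpha$ for all $\alpha\in F$. For given vectors $\bar\theta_\alpha$ (the parameters of the compatibility functions $\Psi_\alpha=e^{\langle\bar\theta_\alpha,\phi_\alpha\rangle}$) the Bethe free energy is $$F(\eta)=-\sum_{\alpha\in F}\langle\bar\theta_\alpha,\eta_\alpha\rangle+\sum_{\alpha\in F}\varphi_\alpha(\eta_\alpha)+\sum_{i\in V}(1-d_i)\varphi_i(\eta_i).$$ **Weights.** A point $\eta\in L$ determines the members $b_\alpha\in\mathcal E_\alpha$ and $b_i\in\mathcal E_i$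 with expectation parameters $\eta_\alpha$ and $\eta_i$. For $i,j\in\alpha$ put $u^\alpha_{i\to j}=\operatorname{Var}_{b_j}(\phi_j)^{-1}\operatorname{Cov}_{b_\alpha}(\phi_j,\phi_i)$, an $r_j\times r_i$ matrix. Let $\vec E$ be the set of directed edges $(\alpha\to i)$ with $i\in\alpha\in F$. For $e=(\alpha\to i)$ and $e'=(\beta\to j)$ write $e'\rightharpoonup e$ if $j\in\alpha$, $j\ne i$ and $\beta\ne\alpha$. Let $\mathcal M(u)$ be the complex block matrix indexed by $\vec E$ whose $(e,e')$ block, of size $r_i\times r_j$, is $u^\alpha_{j\to i}$ if $e'\rightharpoonup e$ and $0$ otherwise. **Theorem.** Let $\eta\in L$ and let $u$ be the weights given by $\eta$. If no eigenvalue of $\mathcal M(u)$ is a real number $\ge 1$, then $F$ is twice continuously differentiable at $\eta$ and its Hessian $\nabla^2F(\eta)$ with respect to the coordinates $\{\eta_{\langle\alpha\rangle},\eta_i\}$ is a positive definite matrix. -/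

import Mathlib

open MeasureTheory ProbabilityTheory

noncomputable section

namespace Bethe

/-- The Hessian matrix of `f` at `x`: its `(a, b)` entry is the second partial derivative of `f`
in the coordinate directions `a` and `b`. -/
def hessian {ι : Type*} [Fintype ι] [DecidableEq ι] (f : (ι → ℝ) → ℝ) (x : ι → ℝ) :
    Matrix ι ι ℝ :=
  Matrix.of fun a b => fderiv ℝ (fderiv ℝ f) x (Pi.single a 1) (Pi.single b 1)

/-- The matrix of covariances of the components of `f` with those of `g`. -/
def covMatrix {X ι κ : Type*} [MeasurableSpace X] (μ : Measure X)
    (f : X → ι → ℝ) (g : X → κ → ℝ) : Matrix ι κ ℝ :=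
  Matrix.of fun a b => covariance (fun x => f x a) (fun x => g x b) μ

/-! ### Exponential families -/

section ExponentialFamily

variable {X ι : Type*} [MeasurableSpace X] [Fintype ι] (ν : Measure X) (φ : X → ι → ℝ)

/-- The log partition function `ψ θ = log ∫ exp ⟨θ, φ⟩ dν`. -/
def logPartition (θ : ι → ℝ) : ℝ :=
  Real.log (∫ x, Real.exp (θ ⬝ᵥ φ x) ∂ν)

/-- The set `Θ` of natural parameters: the interior of the set where `ψ` is finite. -/
def naturalParams : Set (ι → ℝ) :=
  interior {θ | Integrable (fun x => Real.exp (θ ⬝ᵥ φ x)) ν}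

/-- The member of the exponential family with natural parameter `θ`: the distribution whose density
with respect to `ν` is `exp (⟨θ, φ⟩ - ψ θ)`. -/
def expDist (θ : ι → ℝ) : Measure X :=
  ν.withDensity fun x => ENNReal.ofReal (Real.exp (θ ⬝ᵥ φ x - logPartition ν φ θ))

/-- The map `Λ` from natural parameters to expectation parameters. -/
def expectationMap (θ : ι → ℝ) : ι → ℝ :=
  fun a => ∫ x, φ x a ∂(expDist ν φ θ)

/-- The set `Y = Λ(Θ)` of expectation parameters. -/
def expectationParams : Set (ι → ℝ) :=
  expectationMap ν φ '' naturalParams ν φ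

/-- The Legendre transform of the log partition function. -/
def legendre (η : ι → ℝ) : ℝ :=
  ⨆ θ : naturalParams ν φ, ((θ : ι → ℝ) ⬝ᵥ η - logPartition ν φ θ)

/-- The member of the exponential family with expectation parameter `η ∈ Y`. -/
def distOfMean (η : ι → ℝ) : Measure X :=
  expDist ν φ (Function.invFunOn (expectationMap ν φ) (naturalParams ν φ) η)

end ExponentialFamily

/-! ### Hypergraphs and inference families -/

/-- A hypergraph on the vertex set `V`: a finite set of non-empty subsets of `V`. -/
structure Hypergraph (V : Type*) where
  hyperedges : Finset (Finset V)
  nonempty_of_mem : ∀ α ∈ hyperedges, α.Nonempty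

namespace Hypergraph

variable {V : Type*} (H : Hypergraph V)

/-- The hyperedges (factors), as a type. -/
abbrev Factor : Type _ := {α : Finset V // α ∈ H.hyperedges}

/-- The directed edges `α → i`, for a hyperedge `α` and a vertex `i ∈ α`. -/
abbrev DirEdge : Type _ := Σ α : H.Factor, {i : V // i ∈ α.1}

/-- The degree of a vertex: the number of hyperedges that contain it. -/
def degree [DecidableEq V] (i : V) : ℕ := (H.hyperedges.filter fun α => i ∈ α).card

/-- `Feeds e' e` for `e' = (β → j)` and `e = (α → i)` says that `j ∈ α`, `j ≠ i` and `β ≠ α`. -/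
def Feeds (e' e : H.DirEdge) : Prop :=
  (e'.2 : V) ∈ e.1.1 ∧ (e'.2 : V) ≠ (e.2 : V) ∧ e'.1 ≠ e.1

end Hypergraph

/-- Base measures and sufficient statistics for the vertices and the factors of a hypergraph.
The statistic of a factor `α` consists of `φF α` together with the `φ i`, `i ∈ α`. -/
structure FamilyData {V : Type*} (H : Hypergraph V) (X : V → Type*)
    [∀ i, MeasurableSpace (X i)] where
  ν : ∀ i, Measure (X i)
  sigmaFinite : ∀ i, SigmaFinite (ν i)
  /-- The dimension of `φ i`. -/
  r : V → ℕ
  /-- The dimension of `φF α`. -/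
  s : H.Factor → ℕ
  φ : ∀ i, X i → Fin (r i) → ℝ
  φF : ∀ α : H.Factor, (∀ i : {i : V // i ∈ α.1}, X i) → Fin (s α) → ℝ
  measurable_φ : ∀ i, Measurable (φ i)
  measurable_φF : ∀ α, Measurable (φF α)

namespace FamilyData

variable {V : Type*} {H : Hypergraph V} {X : V → Type*}
  [∀ i, MeasurableSpace (X i)] (D : FamilyData H X)

/-- The index set of the components of the full sufficient statistic of the factor `α`. -/
abbrev FactorIdx (α : H.Factor) : Type _ :=
  Fin (D.s α) ⊕ (Σ i : {i : V // i ∈ α.1}, Fin (D.r i))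

/-- The product base measure on the configurations of the factor `α`. -/
def νFactor (α : H.Factor) : Measure (∀ i : {i : V // i ∈ α.1}, X i) :=
  Measure.pi fun i => D.ν i

/-- The full sufficient statistic of the factor `α`. -/
def φFactor (α : H.Factor) (x : ∀ i : {i : V // i ∈ α.1}, X i) : D.FactorIdx α → ℝ :=
  Sum.elim (D.φF α x) fun p => D.φ p.1 (x p.1) p.2

end FamilyData

/-- An inference family: all log partition functions have invertible Hessians, and the marginal at
`i ∈ α` of every member of the family of the factor `α` is a member of the family of `i`. -/
structure InferenceFamily {V : Type*} [DecidableEq V] (H : Hypergraph V) (X : V → Type*)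
    [∀ i, MeasurableSpace (X i)] extends FamilyData H X where
  isUnit_hessian_vertex : ∀ i, ∀ θ ∈ naturalParams (ν i) (φ i),
    IsUnit (hessian (logPartition (ν i) (φ i)) θ)
  isUnit_hessian_factor : ∀ α, ∀ θ ∈ naturalParams (toFamilyData.νFactor α) (toFamilyData.φFactor α),
    IsUnit (hessian (logPartition (toFamilyData.νFactor α) (toFamilyData.φFactor α)) θ)
  marginally_closed : ∀ (α : H.Factor) (i : {i : V // i ∈ α.1}),
    ∀ θ ∈ naturalParams (toFamilyData.νFactor α) (toFamilyData.φFactor α),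
      ∃ θ' ∈ naturalParams (ν i) (φ i),
        (expDist (toFamilyData.νFactor α) (toFamilyData.φFactor α) θ).map (fun x => x i) =
          expDist (ν i) (φ i) θ'

namespace InferenceFamily

variable {V : Type*} [Fintype V] [DecidableEq V] {H : Hypergraph V} {X : V → Type*}
  [∀ i, MeasurableSpace (X i)] (I : InferenceFamily H X)

/-- The index set of the coordinates of a point `{η_⟨α⟩, η_i}` of `L`. -/
abbrev Coord : Type _ := (Σ α : H.Factor, Fin (I.s α)) ⊕ (Σ i : V, Fin (I.r i))

/-- The component `η_i`. -/
def etaVertex (η : I.Coord → ℝ) (i : V) : Fin (I.r i) → ℝ :=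
  fun k => η (Sum.inr ⟨i, k⟩)

/-- The expectation parameter `(η_⟨α⟩, (η_i)_{i ∈ α})` of the factor `α`; the local consistency
constraint of `L` is built in, because the block of `i` is the common value `η_i`. -/
def etaFactor (η : I.Coord → ℝ) (α : H.Factor) : I.FactorIdx α → ℝ :=
  Sum.elim (fun k => η (Sum.inl ⟨α, k⟩)) fun p => I.etaVertex η p.1 p.2

/-- The set `L` of (expectation parameters of) pseudomarginals, in the coordinates
`{η_⟨α⟩, η_i}`. -/
def L : Set (I.Coord → ℝ) :=
  {η | (∀ α, I.etaFactor η α ∈ expectationParams (I.νFactor α) (I.φFactor α)) ∧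
    ∀ i, I.etaVertex η i ∈ expectationParams (I.ν i) (I.φ i)}

/-- The Bethe free energy for the compatibility functions `exp ⟨θbar α, φFactor α⟩`. -/
def betheFreeEnergy (θbar : ∀ α : H.Factor, I.FactorIdx α → ℝ) (η : I.Coord → ℝ) : ℝ :=
  -∑ α : H.Factor, θbar α ⬝ᵥ I.etaFactor η α
    + ∑ α : H.Factor, legendre (I.νFactor α) (I.φFactor α) (I.etaFactor η α)
    + ∑ i : V, (1 - (H.degree i : ℝ)) * legendre (I.ν i) (I.φ i) (I.etaVertex η i)

/-- The vertex belief `b_i` given by `η`. -/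
def beliefVertex (η : I.Coord → ℝ) (i : V) : Measure (X i) :=
  distOfMean (I.ν i) (I.φ i) (I.etaVertex η i)

/-- The factor belief `b_α` given by `η`. -/
def beliefFactor (η : I.Coord → ℝ) (α : H.Factor) : Measure (∀ i : {i : V // i ∈ α.1}, X i) :=
  distOfMean (I.νFactor α) (I.φFactor α) (I.etaFactor η α)

/-- The weight `u^α_{i → j} = Var_{b_j}(φ_j)⁻¹ Cov_{b_α}(φ_j, φ_i)`. -/
def weight (η : I.Coord → ℝ) (α : H.Factor) (i j : {i : V // i ∈ α.1}) :
    Matrix (Fin (I.r j)) (Fin (I.r i)) ℝ :=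
  (covMatrix (I.beliefVertex η j) (I.φ j) (I.φ j))⁻¹ *
    covMatrix (I.beliefFactor η α) (fun x => I.φ j (x j)) (fun x => I.φ i (x i))

end InferenceFamily

open Classical in
/-- The matrix `M(u)` on the functions `f` on directed edges with `f e ∈ ℂ^{r (t e)}`. For
`e = (α → i)` and `e' = (β → j)` its `(e, e')` block is `u^α_{j → i}` if `e'` feeds `e`, and `0`
otherwise. -/
def edgeMatrix {V : Type*} {H : Hypergraph V} {r : V → ℕ}
    (u : ∀ (α : H.Factor) (i j : {i : V // i ∈ α.1}), Matrix (Fin (r j)) (Fin (r i)) ℂ) :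
    Matrix (Σ e : H.DirEdge, Fin (r e.2)) (Σ e : H.DirEdge, Fin (r e.2)) ℂ :=
  Matrix.of fun p q =>
    if h : H.Feeds q.1 p.1 then u p.1.1 ⟨q.1.2, h.1⟩ p.1.2 p.2 q.2 else 0

end Bethe

end

open Filter Topology
open scoped Matrix

noncomputable section

namespace Bethe

/-! The Hessian of a Legendre transform `φ` at a mean parameter is the inverse covariance matrix of
the statistic. Hence the Hessian of the Bethe free energy is `betheMatrix C W`: the forms `(C α)⁻¹`
of the factor covariances, plus `(1 - d_i)` times the forms `(W i)⁻¹` of the vertex covariances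
(`hessian_betheFreeEnergy`). The energy term is linear and contributes nothing. Marginal consistency
makes the diagonal block of `C α` at a vertex `i` equal to `W i` (`factorCov_inr_inr`).

What remains is linear algebra, done by deformation in `posDef_betheMatrix`. Let `C_t α = t C α + (1
- t) diag(1, W i)`. At `t = 0` the degree corrections cancel the repeated vertex terms and the Bethe
matrix is positive definite (`posDef_betheMatrix_vertexBlocks`). A continuous path of symmetric
matrices can lose positive definiteness only by becoming singular (`posDef_of_path`).

Singularity is excluded by the spectral hypothesis. For `x` in the kernel at time `t`, put `y α =
(C_t α)⁻¹ x_α`, `z i = (W i)⁻¹ x_i` and `f (α → i) = z i - (y α)_i`. The kernel equations become `f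
= t M(u) f` (`eq_zero_of_stationary`). If `f ≠ 0`, then `t ≠ 0` and `1 / t ≥ 1` is an eigenvalue of
`M(u)`. So `f = 0`, which forces `z`, `y` and `x` to vanish. -/

/-- The continuous linear functional `v ↦ ⟨v, w⟩`. -/
def dotCLM {ι : Type*} [Fintype ι] (w : ι → ℝ) : (ι → ℝ) →L[ℝ] ℝ :=
  ∑ a, w a • ContinuousLinearMap.proj (R := ℝ) (φ := fun _ : ι => ℝ) a

theorem dotCLM_apply {ι : Type*} [Fintype ι] (w v : ι → ℝ) : dotCLM w v = v ⬝ᵥ w := by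
  simp [dotCLM, dotProduct, mul_comm]

theorem norm_dotCLM_le {ι : Type*} [Fintype ι] (w : ι → ℝ) : ‖dotCLM w‖ ≤ ∑ a, |w a| := by
  refine ContinuousLinearMap.opNorm_le_bound _ (by positivity) fun v => ?_
  rw [dotCLM_apply, dotProduct, Finset.sum_mul]
  refine (norm_sum_le _ _).trans (Finset.sum_le_sum fun a _ => ?_)
  rw [norm_mul, mul_comm, Real.norm_eq_abs (w a)]
  exact mul_le_mul_of_nonneg_left (norm_le_pi_norm v a) (abs_nonneg _)

/-! ### Differentiation of exponential integrals under the integral sign. -/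

section ExpIntegral

variable {X ι : Type*} [MeasurableSpace X] [Fintype ι] {ν : Measure X} {φ : X → ι → ℝ}

/-- The integral of `g` against the unnormalized density `exp ⟨θ, φ⟩`. -/
def expIntegral (ν : Measure X) (φ : X → ι → ℝ) (g : X → ℝ) (θ : ι → ℝ) : ℝ :=
  ∫ x, g x * Real.exp (θ ⬝ᵥ φ x) ∂ν

/-- Near a point of an open set on which `g * exp ⟨θ, φ⟩` is integrable, these functions and their
products with `∑ |φ a|` have a common integrable bound. -/
theorem exists_integrable_bound {g : X → ℝ} {U : Set (ι → ℝ)} (hU : IsOpen U)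
    (hg : ∀ θ ∈ U, Integrable (fun x => g x * Real.exp (θ ⬝ᵥ φ x)) ν) {θ : ι → ℝ} (hθ : θ ∈ U) :
    ∃ δ > 0, ∃ B : X → ℝ, Integrable B ν ∧ ∀ θ' ∈ Metric.ball θ δ, ∀ x,
      |g x| * (1 + ∑ a, |φ x a|) * Real.exp (θ' ⬝ᵥ φ x) ≤ B x := by
  classical
  obtain ⟨ε, hε, hball⟩ := Metric.isOpen_iff.1 hU θ hθ
  obtain ⟨δ, hδ, hδε⟩ : ∃ δ > 0, 2 * δ < ε := ⟨ε / 4, by positivity, by linarith⟩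
  -- The points `θ + v s` are the corners of a cube of half-width `2 * δ` around `θ`. At the corner
  -- whose signs match those of `φ x`, the exponent gains `2 * δ * S`: one `δ * S` pays for moving
  -- from `θ` to `θ'`, the other absorbs the factor `1 + S`. Summing over all corners makes the
  -- bound independent of the signs.
  let v : (ι → Bool) → ι → ℝ := fun s a => if s a then 2 * δ else -(2 * δ)
  have hv : ∀ s, θ + v s ∈ U := fun s => hball <| by
    rw [Metric.mem_ball, dist_eq_norm, add_sub_cancel_left]
    refine lt_of_le_of_lt ((pi_norm_le_iff_of_nonneg (by positivity)).2 fun a => ?_) hδε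
    by_cases h : s a <;> simp [v, h, abs_of_pos hδ]
  refine ⟨δ, hδ, fun x => ∑ s, (1 + 1 / δ) * |g x * Real.exp ((θ + v s) ⬝ᵥ φ x)|,
    integrable_finsetSum _ fun s _ => ((hg _ (hv s)).abs).const_mul _, fun θ' hθ' x => ?_⟩
  set S := ∑ a, |φ x a| with hS
  have hS0 : 0 ≤ S := by positivity
  have h1 : 1 + S ≤ (1 + 1 / δ) * Real.exp (δ * S) := by
    have := Real.add_one_le_exp (δ * S)
    have h2 : (1 + 1 / δ) * (δ * S + 1) = 1 + S + (δ * S + 1 / δ) := by field_simp; ring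
    have h3 : (1 + 1 / δ) * (δ * S + 1) ≤ (1 + 1 / δ) * Real.exp (δ * S) :=
      mul_le_mul_of_nonneg_left this (by positivity)
    have : 0 ≤ δ * S + 1 / δ := by positivity
    linarith
  have h2 : θ' ⬝ᵥ φ x ≤ θ ⬝ᵥ φ x + δ * S := by
    rw [← sub_le_iff_le_add', ← sub_dotProduct, hS, Finset.mul_sum]
    refine Finset.sum_le_sum fun a _ => (le_abs_self _).trans ?_
    rw [abs_mul]
    refine mul_le_mul_of_nonneg_right ?_ (abs_nonneg _)
    have := (norm_le_pi_norm (θ' - θ) a).trans (mem_ball_iff_norm.1 hθ').le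
    exact this
  let s₀ : ι → Bool := fun a => decide (0 ≤ φ x a)
  have h3 : (θ + v s₀) ⬝ᵥ φ x = θ ⬝ᵥ φ x + 2 * δ * S := by
    rw [add_dotProduct, hS, Finset.mul_sum, dotProduct]
    congr 1
    refine Finset.sum_congr rfl fun a _ => ?_
    by_cases h : 0 ≤ φ x a
    · simp [v, s₀, h, abs_of_nonneg h]
    · simp [v, s₀, h, abs_of_neg (not_le.1 h)]
  refine le_trans ?_ (Finset.single_le_sum (f := fun s => (1 + 1 / δ) *
    |g x * Real.exp ((θ + v s) ⬝ᵥ φ x)|) (fun s _ => by positivity) (Finset.mem_univ s₀))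
  have h4 : (1 + S) * Real.exp (θ' ⬝ᵥ φ x) ≤ (1 + 1 / δ) * Real.exp ((θ + v s₀) ⬝ᵥ φ x) := by
    calc (1 + S) * Real.exp (θ' ⬝ᵥ φ x)
        ≤ ((1 + 1 / δ) * Real.exp (δ * S)) * Real.exp (θ ⬝ᵥ φ x + δ * S) :=
          mul_le_mul h1 (Real.exp_le_exp.2 h2) (by positivity) (by positivity)
      _ = (1 + 1 / δ) * Real.exp ((θ + v s₀) ⬝ᵥ φ x) := by
          rw [mul_assoc, ← Real.exp_add, h3]; ring_nf
  simp only [abs_mul, Real.abs_exp]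
  calc _ = |g x| * ((1 + S) * Real.exp (θ' ⬝ᵥ φ x)) := by ring
    _ ≤ |g x| * ((1 + 1 / δ) * Real.exp ((θ + v s₀) ⬝ᵥ φ x)) :=
        mul_le_mul_of_nonneg_left h4 (abs_nonneg _)
    _ = _ := by ring

theorem measurable_exp_dotProduct (hφ : Measurable φ) (θ : ι → ℝ) :
    Measurable fun x => Real.exp (θ ⬝ᵥ φ x) := by
  unfold dotProduct
  fun_prop

/-- Openness of `U` leaves room to absorb the factor `φ x a`, so the integrability hypothesis
reproduces itself and can be iterated to get all moments. -/
theorem integrable_mul_statistic {g : X → ℝ} (hgm : Measurable g) (hφ : Measurable φ)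
    {U : Set (ι → ℝ)} (hU : IsOpen U)
    (hg : ∀ θ ∈ U, Integrable (fun x => g x * Real.exp (θ ⬝ᵥ φ x)) ν) (a : ι) :
    ∀ θ ∈ U, Integrable (fun x => (g x * φ x a) * Real.exp (θ ⬝ᵥ φ x)) ν := by
  intro θ hθ
  obtain ⟨δ, hδ, B, hB, hb⟩ := exists_integrable_bound hU hg hθ
  have hm := measurable_exp_dotProduct hφ θ
  refine hB.mono' (by fun_prop) (Eventually.of_forall fun x => ?_)
  refine le_trans ?_ (hb θ (Metric.mem_ball_self hδ) x)
  rw [norm_mul, Real.norm_eq_abs, Real.norm_eq_abs, Real.abs_exp, abs_mul]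
  refine mul_le_mul_of_nonneg_right (mul_le_mul_of_nonneg_left ?_ (abs_nonneg _))
    (Real.exp_pos _).le
  have := Finset.single_le_sum (f := fun a => |φ x a|) (fun _ _ => abs_nonneg _)
    (Finset.mem_univ a)
  linarith

theorem hasFDerivAt_expIntegral {g : X → ℝ} (hgm : Measurable g) (hφ : Measurable φ)
    {U : Set (ι → ℝ)} (hU : IsOpen U)
    (hg : ∀ θ ∈ U, Integrable (fun x => g x * Real.exp (θ ⬝ᵥ φ x)) ν) {θ : ι → ℝ} (hθ : θ ∈ U) :
    HasFDerivAt (expIntegral ν φ g)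
      (dotCLM fun a => expIntegral ν φ (fun x => g x * φ x a) θ) θ := by
  obtain ⟨δ, hδ, B, hB, hb⟩ := exists_integrable_bound hU hg hθ
  have hm := measurable_exp_dotProduct hφ
  have hd : ∀ (x : X) (θ' : ι → ℝ), HasFDerivAt (fun θ => g x * Real.exp (θ ⬝ᵥ φ x))
      ((g x * Real.exp (θ' ⬝ᵥ φ x)) • dotCLM (φ x)) θ' := by
    intro x θ'
    have h : HasFDerivAt (fun θ : ι → ℝ => θ ⬝ᵥ φ x) (dotCLM (φ x)) θ' := by
      have := (dotCLM (φ x)).hasFDerivAt (x := θ')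
      simpa only [funext fun v => dotCLM_apply (φ x) v] using this
    simpa [smul_smul] using h.exp.const_mul (g x)
  have key := hasFDerivAt_integral_of_dominated_of_fderiv_le (𝕜 := ℝ) (μ := ν)
    (F := fun θ x => g x * Real.exp (θ ⬝ᵥ φ x))
    (F' := fun θ x => (g x * Real.exp (θ ⬝ᵥ φ x)) • dotCLM (φ x)) (x₀ := θ) (bound := B)
    (Metric.ball_mem_nhds θ hδ)
    (Eventually.of_forall fun θ => by have := hm θ; fun_prop)
    (hg θ hθ)
    (by
      have := hm θ
      unfold dotCLM
      simp only [Finset.smul_sum, smul_smul]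
      refine Finset.aestronglyMeasurable_fun_sum _ fun a _ => ?_
      exact AEStronglyMeasurable.smul_const (by fun_prop) _)
    (Eventually.of_forall fun x θ' hθ' => by
      refine le_trans ?_ (hb θ' hθ' x)
      rw [norm_smul, norm_mul, Real.norm_eq_abs, Real.norm_eq_abs, Real.abs_exp,
        mul_right_comm]
      refine mul_le_mul_of_nonneg_right (mul_le_mul_of_nonneg_left ?_ (abs_nonneg _))
        (Real.exp_pos _).le
      linarith [norm_dotCLM_le (φ x)])
    hB (Eventually.of_forall fun x θ' _ => hd x θ')
  refine key.congr_fderiv ?_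
  have hi := fun a => integrable_mul_statistic hgm hφ hU hg a θ hθ
  simp only [dotCLM, Finset.smul_sum, smul_smul]
  rw [integral_finsetSum]
  · refine Finset.sum_congr rfl fun a _ => ?_
    rw [integral_smul_const]
    congr 2
    ext x
    ring
  · intro a _
    refine Integrable.smul_const ?_ _
    convert hi a using 2
    ring

/-- The partial derivatives are again integrals of this type, with `g` replaced by `g * φ a`; this
is why the induction on `n` is over all `g` at once. -/
theorem contDiffOn_expIntegral (hφ : Measurable φ) {U : Set (ι → ℝ)} (hU : IsOpen U) (n : ℕ) :
    ∀ {g : X → ℝ}, Measurable g →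
      (∀ θ ∈ U, Integrable (fun x => g x * Real.exp (θ ⬝ᵥ φ x)) ν) →
      ContDiffOn ℝ n (expIntegral ν φ g) U := by
  induction n with
  | zero =>
    intro g hgm hg
    exact contDiffOn_zero.2 fun θ hθ =>
      (hasFDerivAt_expIntegral hgm hφ hU hg hθ).continuousAt.continuousWithinAt
  | succ n ih =>
    intro g hgm hg
    push_cast
    refine (contDiffOn_succ_iff_fderiv_of_isOpen hU).2 ⟨fun θ hθ =>
      (hasFDerivAt_expIntegral hgm hφ hU hg hθ).differentiableAt.differentiableWithinAt,
      by simp, ?_⟩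
    refine ContDiffOn.congr ?_ fun θ hθ => (hasFDerivAt_expIntegral hgm hφ hU hg hθ).fderiv
    unfold dotCLM
    exact ContDiffOn.sum fun a _ => (ih (by fun_prop)
      (integrable_mul_statistic hgm hφ hU hg a)).smul contDiffOn_const

end ExpIntegral

/-! ### Exponential families: the derivatives of `ψ` and `Λ` are moments. -/

section ExponentialFamily

variable {X ι : Type*} [MeasurableSpace X] [Fintype ι] {ν : Measure X} {φ : X → ι → ℝ}

theorem isOpen_naturalParams : IsOpen (naturalParams ν φ) := isOpen_interior

theorem integrable_exp_of_mem {θ : ι → ℝ} (hθ : θ ∈ naturalParams ν φ) :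
    Integrable (fun x => Real.exp (θ ⬝ᵥ φ x)) ν :=
  interior_subset (s := {θ | Integrable (fun x => Real.exp (θ ⬝ᵥ φ x)) ν}) hθ

theorem integrable_one_mul_exp : ∀ θ ∈ naturalParams ν φ,
    Integrable (fun x => (fun _ => (1 : ℝ)) x * Real.exp (θ ⬝ᵥ φ x)) ν := fun θ hθ => by
  simpa using integrable_exp_of_mem hθ

theorem integrable_statistic_mul_exp (hφ : Measurable φ) (a : ι) : ∀ θ ∈ naturalParams ν φ,
    Integrable (fun x => φ x a * Real.exp (θ ⬝ᵥ φ x)) ν := by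
  simpa using integrable_mul_statistic measurable_const hφ isOpen_naturalParams
    integrable_one_mul_exp a

theorem integrable_statistic_mul_statistic_mul_exp (hφ : Measurable φ) (a b : ι) :
    ∀ θ ∈ naturalParams ν φ, Integrable (fun x => (φ x a * φ x b) * Real.exp (θ ⬝ᵥ φ x)) ν :=
  integrable_mul_statistic (by fun_prop) hφ isOpen_naturalParams
    (integrable_statistic_mul_exp hφ a) b

theorem convex_naturalParams (hφ : Measurable φ) : Convex ℝ (naturalParams ν φ) := by
  refine Convex.interior fun θ₁ h₁ θ₂ h₂ s t hs ht hst => ?_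
  refine ((Integrable.const_mul h₁ s).add (Integrable.const_mul h₂ t)).mono'
    (measurable_exp_dotProduct hφ _).aestronglyMeasurable (Eventually.of_forall fun x => ?_)
  rw [Real.norm_eq_abs, Real.abs_exp, add_dotProduct, smul_dotProduct, smul_dotProduct]
  exact convexOn_exp.2 (Set.mem_univ _) (Set.mem_univ _) hs ht hst

/-- The partition function. -/
abbrev partition (ν : Measure X) (φ : X → ι → ℝ) : (ι → ℝ) → ℝ := expIntegral ν φ fun _ => 1

theorem logPartition_eq : logPartition ν φ = fun θ => Real.log (partition ν φ θ) := by
  ext θ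
  simp [logPartition, expIntegral]

theorem partition_pos [NeZero ν] {θ : ι → ℝ} (hθ : θ ∈ naturalParams ν φ) :
    0 < partition ν φ θ := by
  simpa [expIntegral] using integral_exp_pos (μ := ν) (integrable_exp_of_mem hθ)

theorem exp_sub_logPartition [NeZero ν] {θ : ι → ℝ} (hθ : θ ∈ naturalParams ν φ) (x : X) :
    Real.exp (θ ⬝ᵥ φ x - logPartition ν φ θ) = (partition ν φ θ)⁻¹ * Real.exp (θ ⬝ᵥ φ x) := by
  rw [logPartition_eq, Real.exp_sub, Real.exp_log (partition_pos hθ), div_eq_inv_mul]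

theorem measurable_density (hφ : Measurable φ) (θ : ι → ℝ) :
    Measurable fun x => ENNReal.ofReal (Real.exp (θ ⬝ᵥ φ x - logPartition ν φ θ)) := by
  unfold dotProduct
  fun_prop

theorem integral_expDist [NeZero ν] (hφ : Measurable φ) {θ : ι → ℝ}
    (hθ : θ ∈ naturalParams ν φ) (f : X → ℝ) :
    ∫ x, f x ∂(expDist ν φ θ) = expIntegral ν φ f θ / partition ν φ θ := by
  rw [expDist, integral_withDensity_eq_integral_toReal_smul (measurable_density hφ θ)
    (by simp), div_eq_inv_mul, expIntegral, ← integral_const_mul]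
  congr 1 with x
  rw [ENNReal.toReal_ofReal (Real.exp_pos _).le, exp_sub_logPartition hθ, smul_eq_mul]
  ring

theorem integrable_expDist [NeZero ν] (hφ : Measurable φ) {θ : ι → ℝ}
    (hθ : θ ∈ naturalParams ν φ) {f : X → ℝ}
    (hf : Integrable (fun x => f x * Real.exp (θ ⬝ᵥ φ x)) ν) :
    Integrable f (expDist ν φ θ) := by
  rw [expDist, integrable_withDensity_iff_integrable_smul' (measurable_density hφ θ) (by simp)]
  convert hf.const_mul (partition ν φ θ)⁻¹ using 2
  rw [ENNReal.toReal_ofReal (Real.exp_pos _).le, exp_sub_logPartition hθ, smul_eq_mul]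
  ring

theorem isProbabilityMeasure_expDist [NeZero ν] (hφ : Measurable φ) {θ : ι → ℝ}
    (hθ : θ ∈ naturalParams ν φ) : IsProbabilityMeasure (expDist ν φ θ) := by
  have hfin : IsFiniteMeasure (expDist ν φ θ) := by
    have := integrable_expDist hφ hθ (integrable_one_mul_exp θ hθ)
    simpa [integrable_const_iff] using this
  have h := integral_expDist hφ hθ (fun _ => 1)
  rw [div_self (partition_pos hθ).ne', integral_const, smul_eq_mul, mul_one] at h
  exact ⟨by simpa [Measure.real, ENNReal.toReal_eq_one_iff] using h⟩

theorem memLp_statistic [NeZero ν] (hφ : Measurable φ) {θ : ι → ℝ}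
    (hθ : θ ∈ naturalParams ν φ) (a : ι) : MemLp (fun x => φ x a) 2 (expDist ν φ θ) := by
  rw [memLp_two_iff_integrable_sq (by fun_prop)]
  refine integrable_expDist hφ hθ ?_
  simpa only [sq] using integrable_statistic_mul_statistic_mul_exp hφ a a θ hθ

theorem expectationMap_eq [NeZero ν] (hφ : Measurable φ) {θ : ι → ℝ}
    (hθ : θ ∈ naturalParams ν φ) (a : ι) : expectationMap ν φ θ a =
      expIntegral ν φ (fun x => φ x a) θ / partition ν φ θ :=
  integral_expDist hφ hθ _

theorem covMatrix_expDist_apply [NeZero ν] (hφ : Measurable φ) {θ : ι → ℝ}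
    (hθ : θ ∈ naturalParams ν φ) (a b : ι) : covMatrix (expDist ν φ θ) φ φ a b =
      expIntegral ν φ (fun x => φ x a * φ x b) θ / partition ν φ θ -
        expectationMap ν φ θ a * expectationMap ν φ θ b := by
  have := isProbabilityMeasure_expDist hφ hθ
  rw [covMatrix, Matrix.of_apply,
    covariance_eq_sub (memLp_statistic hφ hθ a) (memLp_statistic hφ hθ b),
    ← integral_expDist hφ hθ]
  rfl

theorem hasFDerivAt_partition (hφ : Measurable φ) {θ : ι → ℝ} (hθ : θ ∈ naturalParams ν φ) :
    HasFDerivAt (partition ν φ) (dotCLM fun a => expIntegral ν φ (fun x => φ x a) θ) θ := by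
  simpa using hasFDerivAt_expIntegral measurable_const hφ isOpen_naturalParams
    integrable_one_mul_exp hθ

/-- The pairing `w ↦ (v ↦ ⟨v, w⟩)` as a continuous linear map. -/
def dotCLML : (ι → ℝ) →L[ℝ] (ι → ℝ) →L[ℝ] ℝ :=
  LinearMap.toContinuousLinearMap
    { toFun := dotCLM
      map_add' := fun w w' => by ext v; simp [dotCLM, add_mul, Finset.sum_add_distrib]
      map_smul' := fun c w => by ext v; simp [dotCLM, Finset.mul_sum, mul_assoc] }

theorem dotCLML_apply (w : ι → ℝ) : dotCLML w = dotCLM w := rfl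

theorem smul_dotCLM (c : ℝ) (w : ι → ℝ) : c • dotCLM w = dotCLM (c • w) :=
  (dotCLML.map_smul c w).symm

theorem hasFDerivAt_logPartition [NeZero ν] (hφ : Measurable φ) {θ : ι → ℝ}
    (hθ : θ ∈ naturalParams ν φ) :
    HasFDerivAt (logPartition ν φ) (dotCLM (expectationMap ν φ θ)) θ := by
  rw [logPartition_eq]
  refine ((hasFDerivAt_partition hφ hθ).log (partition_pos hθ).ne').congr_fderiv ?_
  rw [smul_dotCLM]
  congr 1
  ext a
  rw [expectationMap_eq hφ hθ, Pi.smul_apply, smul_eq_mul, div_eq_inv_mul]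

/-- The quotient rule for `E[φ a] = ∫ φ a e^⟨θ, φ⟩ / ∫ e^⟨θ, φ⟩` gives `E[φ a φ b] - E[φ a] E[φ b]`.
-/
theorem hasFDerivAt_expectationMap_apply [NeZero ν] (hφ : Measurable φ) {θ : ι → ℝ}
    (hθ : θ ∈ naturalParams ν φ) (a : ι) :
    HasFDerivAt (fun θ => expectationMap ν φ θ a)
      (dotCLM (covMatrix (expDist ν φ θ) φ φ a)) θ := by
  have hZ := (partition_pos hθ).ne'
  have h := (hasFDerivAt_expIntegral (ν := ν) (g := fun x => φ x a) (by fun_prop) hφ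
    isOpen_naturalParams (integrable_statistic_mul_exp hφ a) hθ).mul
      ((hasDerivAt_inv hZ).comp_hasFDerivAt θ (hasFDerivAt_partition hφ hθ))
  have heq : (fun θ => expectationMap ν φ θ a) =ᶠ[𝓝 θ]
      fun θ => expIntegral ν φ (fun x => φ x a) θ * (partition ν φ θ)⁻¹ := by
    filter_upwards [isOpen_naturalParams.mem_nhds hθ] with θ' hθ'
    rw [expectationMap_eq hφ hθ', div_eq_mul_inv]
  refine (h.congr_of_eventuallyEq heq).congr_fderiv ?_
  ext v
  simp only [add_apply, smul_apply, dotCLM_apply, Function.comp_apply,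
    smul_eq_mul, dotProduct, covMatrix_expDist_apply hφ hθ, expectationMap_eq hφ hθ]
  simp only [Finset.mul_sum, ← Finset.sum_add_distrib]
  refine Finset.sum_congr rfl fun b _ => ?_
  field_simp
  ring

theorem hasFDerivAt_expectationMap [NeZero ν] (hφ : Measurable φ) {θ : ι → ℝ}
    (hθ : θ ∈ naturalParams ν φ) :
    HasFDerivAt (expectationMap ν φ)
      (Matrix.mulVecLin (covMatrix (expDist ν φ θ) φ φ)).toContinuousLinearMap θ := by
  rw [hasFDerivAt_pi']
  intro a
  refine (hasFDerivAt_expectationMap_apply hφ hθ a).congr_fderiv ?_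
  ext v
  simp [dotCLM_apply, Matrix.mulVec, dotProduct_comm]

theorem contDiffAt_expectationMap [NeZero ν] (hφ : Measurable φ) {θ : ι → ℝ}
    (hθ : θ ∈ naturalParams ν φ) (n : ℕ) : ContDiffAt ℝ n (expectationMap ν φ) θ := by
  have hO := (isOpen_naturalParams (ν := ν) (φ := φ)).mem_nhds hθ
  rw [contDiffAt_pi]
  intro a
  have h1 := (contDiffOn_expIntegral (ν := ν) hφ isOpen_naturalParams n (g := fun x => φ x a)
    (by fun_prop) (integrable_statistic_mul_exp hφ a)).contDiffAt hO
  have h2 := (contDiffOn_expIntegral (ν := ν) hφ isOpen_naturalParams n (g := fun _ => 1)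
    (by fun_prop) integrable_one_mul_exp).contDiffAt hO
  refine (h1.div h2 (partition_pos hθ).ne').congr_of_eventuallyEq ?_
  filter_upwards [hO] with θ' hθ'
  exact expectationMap_eq hφ hθ' a

theorem hessian_logPartition [NeZero ν] [DecidableEq ι] (hφ : Measurable φ) {θ : ι → ℝ}
    (hθ : θ ∈ naturalParams ν φ) :
    hessian (logPartition ν φ) θ = covMatrix (expDist ν φ θ) φ φ := by
  have heq : fderiv ℝ (logPartition ν φ) =ᶠ[𝓝 θ] dotCLML ∘ expectationMap ν φ := by
    filter_upwards [isOpen_naturalParams.mem_nhds hθ] with θ' hθ'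
    exact (hasFDerivAt_logPartition hφ hθ').fderiv
  have hd := (dotCLML (ι := ι)).hasFDerivAt.comp θ (hasFDerivAt_expectationMap hφ hθ)
  ext a b
  rw [hessian, Matrix.of_apply, heq.fderiv_eq, HasFDerivAt.fderiv hd]
  simp [dotCLML_apply, dotCLM_apply, covMatrix, covariance_comm]

/-- The quadratic form at `v` is the variance of `⟨v, φ⟩`. -/
theorem posSemidef_covMatrix [NeZero ν] (hφ : Measurable φ) {θ : ι → ℝ}
    (hθ : θ ∈ naturalParams ν φ) : (covMatrix (expDist ν φ θ) φ φ).PosSemidef := by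
  have := isProbabilityMeasure_expDist hφ hθ
  refine Matrix.PosSemidef.of_dotProduct_mulVec_nonneg ?_ fun v => ?_
  · ext a b
    simp [covMatrix, covariance_comm]
  · have h : v ⬝ᵥ covMatrix (expDist ν φ θ) φ φ *ᵥ v =
        covariance (fun x => ∑ a, v a * φ x a) (fun x => ∑ a, v a * φ x a) (expDist ν φ θ) := by
      rw [covariance_fun_sum_fun_sum (fun a => (memLp_statistic hφ hθ a).const_mul _)
        (fun a => (memLp_statistic hφ hθ a).const_mul _)]
      simp only [covariance_const_mul_left, covariance_const_mul_right, dotProduct,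
        Matrix.mulVec, Finset.mul_sum, covMatrix, Matrix.of_apply]
      refine Finset.sum_congr rfl fun a _ => Finset.sum_congr rfl fun b _ => by ring
    rw [star_trivial, h, covariance_self]
    · exact variance_nonneg _ _
    · fun_prop

/-- The degenerate case of a zero base measure, where no probability distribution exists. Since
`Real.log 0 = 0`, the log partition function is identically `0`, and a zero matrix is invertible
only in size zero. -/
theorem isEmpty_of_isUnit_hessian [DecidableEq ι] {θ : ι → ℝ} (hν : ν = 0)
    (hu : IsUnit (hessian (logPartition ν φ) θ)) : IsEmpty ι := by
  have h0 : logPartition ν φ = fun _ => 0 := by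
    ext θ
    simp [logPartition, hν]
  have : hessian (logPartition ν φ) θ = 0 := by
    ext a b
    simp [hessian, h0]
  rw [this] at hu
  by_contra hne
  rw [not_isEmpty_iff] at hne
  exact not_isUnit_zero hu

end ExponentialFamily

/-! ### The Legendre transform and its Hessian. -/

section Legendre

variable {X ι : Type*} [MeasurableSpace X] [Fintype ι] {ν : Measure X} {φ : X → ι → ℝ}

/-- The supporting hyperplane inequality for `ψ`. It is `1 + u ≤ e^u` with `u = ⟨θ - θ₀, φ⟩ - m`,
integrated against the density at `θ₀`, under which `u` has mean zero. -/
theorem logPartition_add_le [NeZero ν] (hφ : Measurable φ) {θ₀ θ : ι → ℝ}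
    (hθ₀ : θ₀ ∈ naturalParams ν φ) (hθ : θ ∈ naturalParams ν φ) :
    logPartition ν φ θ₀ + (θ - θ₀) ⬝ᵥ expectationMap ν φ θ₀ ≤ logPartition ν φ θ := by
  set m := (θ - θ₀) ⬝ᵥ expectationMap ν φ θ₀ with hm
  have hZ₀ := partition_pos hθ₀
  have hsum : ∀ x, ((θ - θ₀) ⬝ᵥ φ x) * Real.exp (θ₀ ⬝ᵥ φ x) =
      ∑ a, (θ - θ₀) a * (φ x a * Real.exp (θ₀ ⬝ᵥ φ x)) := fun x => by
    rw [dotProduct, Finset.sum_mul]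
    exact Finset.sum_congr rfl fun a _ => mul_assoc _ _ _
  have hstat : Integrable (fun x => ((θ - θ₀) ⬝ᵥ φ x) * Real.exp (θ₀ ⬝ᵥ φ x)) ν := by
    simp only [hsum]
    exact integrable_finsetSum _ fun a _ =>
      (integrable_statistic_mul_exp hφ a θ₀ hθ₀).const_mul _
  have hone := integrable_exp_of_mem hθ₀
  have hstat_int : ∫ x, ((θ - θ₀) ⬝ᵥ φ x) * Real.exp (θ₀ ⬝ᵥ φ x) ∂ν = m * partition ν φ θ₀ := by
    have : ∀ a, expIntegral ν φ (fun x => φ x a) θ₀ =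
        expectationMap ν φ θ₀ a * partition ν φ θ₀ := fun a => by
      rw [expectationMap_eq hφ hθ₀, div_mul_cancel₀ _ hZ₀.ne']
    simp only [hsum]
    rw [hm, dotProduct, Finset.sum_mul, integral_finsetSum _ fun a _ =>
      (integrable_statistic_mul_exp hφ a θ₀ hθ₀).const_mul _]
    refine Finset.sum_congr rfl fun a _ => ?_
    rw [integral_const_mul, mul_assoc, ← this]
    rfl
  have hle : Real.exp m * partition ν φ θ₀ ≤ partition ν φ θ := by
    have h1 : Real.exp m * partition ν φ θ₀ = ∫ x, Real.exp m *
        (((θ - θ₀) ⬝ᵥ φ x) * Real.exp (θ₀ ⬝ᵥ φ x) + (1 - m) * Real.exp (θ₀ ⬝ᵥ φ x)) ∂ν := by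
      rw [integral_const_mul, integral_add hstat (hone.const_mul _), hstat_int,
        integral_const_mul]
      simp only [partition, expIntegral, one_mul]
      ring
    rw [h1, partition, expIntegral]
    refine integral_mono ((hstat.add (hone.const_mul _)).const_mul _)
      (integrable_one_mul_exp θ hθ) fun x => ?_
    have h2 := Real.add_one_le_exp ((θ - θ₀) ⬝ᵥ φ x - m)
    have h3 : Real.exp (θ ⬝ᵥ φ x) =
        Real.exp m * (Real.exp ((θ - θ₀) ⬝ᵥ φ x - m) * Real.exp (θ₀ ⬝ᵥ φ x)) := by
      rw [← Real.exp_add, ← Real.exp_add, sub_dotProduct]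
      ring_nf
    simp only [one_mul]
    rw [h3, ← add_mul]
    gcongr
    linarith
  rw [logPartition_eq]
  calc Real.log (partition ν φ θ₀) + m = Real.log (Real.exp m * partition ν φ θ₀) := by
        rw [Real.log_mul (Real.exp_ne_zero _) hZ₀.ne', Real.log_exp, add_comm]
    _ ≤ _ := Real.log_le_log (by positivity) hle

theorem hasFDerivAt_dotProduct_self {G : (ι → ℝ) → ι → ℝ} {y : ι → ℝ}
    {G' : (ι → ℝ) →L[ℝ] (ι → ℝ)} (hG : HasFDerivAt G G' y) :
    HasFDerivAt (fun y => G y ⬝ᵥ y) (dotCLM (G y) + (dotCLM y).comp G') y := by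
  have h := ((dotCLML (ι := ι)).hasFDerivAt.comp y hG).clm_apply (hasFDerivAt_id y)
  have heq : (fun y => G y ⬝ᵥ y) = fun y => (dotCLML ∘ G) y (id y) := by
    ext z
    rw [Function.comp_apply, dotCLML_apply, dotCLM_apply, dotProduct_comm]
    rfl
  rw [heq]
  refine h.congr_fderiv ?_
  refine ContinuousLinearMap.ext fun v => ?_
  simp only [add_apply, ContinuousLinearMap.comp_apply,
    ContinuousLinearMap.flip_apply, Function.comp_apply, dotCLML_apply, dotCLM_apply,
    ContinuousLinearMap.id_apply, id]
  rw [dotProduct_comm y]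

/-- By the supporting hyperplane at `θ`, the supremum is bounded and attained at `θ`. -/
theorem legendre_expectationMap [NeZero ν] (hφ : Measurable φ) {θ : ι → ℝ}
    (hθ : θ ∈ naturalParams ν φ) :
    legendre ν φ (expectationMap ν φ θ) =
      θ ⬝ᵥ expectationMap ν φ θ - logPartition ν φ θ := by
  have hle : ∀ θ' : naturalParams ν φ, (θ' : ι → ℝ) ⬝ᵥ expectationMap ν φ θ -
      logPartition ν φ θ' ≤ θ ⬝ᵥ expectationMap ν φ θ - logPartition ν φ θ := fun θ' => by
    have := logPartition_add_le hφ hθ θ'.2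
    rw [sub_dotProduct] at this
    linarith
  have : Nonempty (naturalParams ν φ) := ⟨⟨θ, hθ⟩⟩
  refine le_antisymm (ciSup_le hle) ?_
  exact le_ciSup (f := fun θ' : naturalParams ν φ => (θ' : ι → ℝ) ⬝ᵥ expectationMap ν φ θ -
      logPartition ν φ θ') ⟨_, Set.forall_mem_range.2 hle⟩ ⟨θ, hθ⟩

variable [DecidableEq ι]

theorem posDef_covMatrix (hφ : Measurable φ)
    (hu : ∀ θ ∈ naturalParams ν φ, IsUnit (hessian (logPartition ν φ) θ)) {θ : ι → ℝ}
    (hθ : θ ∈ naturalParams ν φ) : (covMatrix (expDist ν φ θ) φ φ).PosDef := by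
  by_cases hν : ν = 0
  · have := isEmpty_of_isUnit_hessian hν (hu θ hθ)
    exact Matrix.PosDef.of_dotProduct_mulVec_pos (Subsingleton.elim _ _)
      fun x hx => (hx (Subsingleton.elim _ _)).elim
  · have : NeZero ν := ⟨hν⟩
    rw [(posSemidef_covMatrix hφ hθ).posDef_iff_isUnit, ← hessian_logPartition hφ hθ]
    exact hu θ hθ

/-- If `Λ` agreed at two parameters, Rolle's theorem on the segment between them, which stays in the
convex set `Θ`, would give a zero of `⟨v, C v⟩` with `v ≠ 0`, against positive definiteness of the
covariance. Injectivity makes the choice in `distOfMean` unambiguous. -/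
theorem injOn_expectationMap (hφ : Measurable φ)
    (hu : ∀ θ ∈ naturalParams ν φ, IsUnit (hessian (logPartition ν φ) θ)) :
    Set.InjOn (expectationMap ν φ) (naturalParams ν φ) := by
  intro θ₁ h₁ θ₂ h₂ heq
  by_cases hν : ν = 0
  · have := isEmpty_of_isUnit_hessian hν (hu θ₁ h₁)
    exact Subsingleton.elim _ _
  have : NeZero ν := ⟨hν⟩
  by_contra hne
  set v := θ₂ - θ₁ with hv
  have hv0 : v ≠ 0 := sub_ne_zero.2 (Ne.symm hne)
  have hmem : ∀ s ∈ Set.Icc (0 : ℝ) 1, θ₁ + s • v ∈ naturalParams ν φ := fun s hs =>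
    (convex_naturalParams hφ).add_smul_sub_mem h₁ h₂ hs
  have hd : ∀ s ∈ Set.Icc (0 : ℝ) 1,
      HasDerivAt (fun s : ℝ => dotCLM v (expectationMap ν φ (θ₁ + s • v)))
        (v ⬝ᵥ covMatrix (expDist ν φ (θ₁ + s • v)) φ φ *ᵥ v) s := by
    intro s hs
    have hline : HasDerivAt (fun s : ℝ => θ₁ + s • v) v s := by
      simpa using ((hasDerivAt_id s).smul_const v).const_add θ₁
    have h := (dotCLM v).hasFDerivAt.comp_hasDerivAt s
      ((hasFDerivAt_expectationMap hφ (hmem s hs)).comp_hasDerivAt s hline)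
    refine h.congr_deriv ?_
    rw [dotCLM_apply, dotProduct_comm]
    rfl
  obtain ⟨s, hs, h0⟩ := exists_hasDerivAt_eq_zero (f' := fun s : ℝ =>
      v ⬝ᵥ covMatrix (expDist ν φ (θ₁ + s • v)) φ φ *ᵥ v) zero_lt_one
    (fun s hs => (hd s hs).continuousAt.continuousWithinAt) (by simp [hv, heq])
    (fun s hs => hd s (Set.Ioo_subset_Icc_self hs))
  have := (posDef_covMatrix hφ hu (hmem s (Set.Ioo_subset_Icc_self hs))).dotProduct_mulVec_pos hv0
  rw [star_trivial] at this
  exact this.ne' h0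

/-- The inverse function theorem gives a local `C¹` inverse `G` of `Λ`, and near `η` the transform
equals `⟨G y, y⟩ - ψ (G y)`. Its gradient is `G`, so it is `C²` with Hessian `DG = (DΛ)⁻¹ = C⁻¹`. -/
theorem contDiffAt_legendre_expectationMap [NeZero ν] (hφ : Measurable φ)
    (hu : ∀ θ ∈ naturalParams ν φ, IsUnit (hessian (logPartition ν φ) θ)) {θ : ι → ℝ}
    (hθ : θ ∈ naturalParams ν φ) :
    ContDiffAt ℝ 2 (legendre ν φ) (expectationMap ν φ θ) ∧ ∀ v w,
      fderiv ℝ (fderiv ℝ (legendre ν φ)) (expectationMap ν φ θ) v w =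
        v ⬝ᵥ (covMatrix (expDist ν φ θ) φ φ)⁻¹ *ᵥ w := by
  set C := covMatrix (expDist ν φ θ) φ φ with hC
  have hCpd : C.PosDef := posDef_covMatrix hφ hu hθ
  have hCdet : IsUnit C.det := (Matrix.isUnit_iff_isUnit_det _).1 hCpd.isUnit
  let e : (ι → ℝ) ≃L[ℝ] (ι → ℝ) :=
    (LinearEquiv.ofLinearMap C.mulVecLin C⁻¹.mulVecLin
      (by rw [← Matrix.mulVecLin_mul, C.mul_nonsing_inv hCdet, Matrix.mulVecLin_one])
      (by rw [← Matrix.mulVecLin_mul, C.nonsing_inv_mul hCdet, Matrix.mulVecLin_one])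
      ).toContinuousLinearEquiv
  have hΛ : HasFDerivAt (expectationMap ν φ) (e : (ι → ℝ) →L[ℝ] (ι → ℝ)) θ :=
    hasFDerivAt_expectationMap hφ hθ
  have hsm : ContDiffAt ℝ 1 (expectationMap ν φ) θ := by
    exact_mod_cast contDiffAt_expectationMap hφ hθ 1
  have hst := hsm.hasStrictFDerivAt' hΛ one_ne_zero
  set G := hsm.localInverse hΛ one_ne_zero with hG
  set η := expectationMap ν φ θ with hη
  have hGsm : ContDiffAt ℝ 1 G η := hsm.to_localInverse hΛ one_ne_zero
  have hGη : G η = θ := hsm.localInverse_apply_image hΛ one_ne_zero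
  have hGd : HasFDerivAt G (e.symm : (ι → ℝ) →L[ℝ] (ι → ℝ)) η := hst.to_localInverse.hasFDerivAt
  have hright : ∀ᶠ y in 𝓝 η, expectationMap ν φ (G y) = y := hst.eventually_right_inverse
  have hmem : ∀ᶠ y in 𝓝 η, G y ∈ naturalParams ν φ :=
    hGsm.continuousAt.eventually_mem (by rw [hGη]; exact isOpen_naturalParams.mem_nhds hθ)
  have hdiff : ∀ᶠ y in 𝓝 η, DifferentiableAt ℝ G y :=
    (hGsm.eventually (by simp)).mono fun y hy => hy.differentiableAt one_ne_zero
  have hleg : legendre ν φ =ᶠ[𝓝 η] fun y => G y ⬝ᵥ y - logPartition ν φ (G y) := by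
    filter_upwards [hright, hmem] with y hy hy'
    conv_lhs => rw [← hy]
    rw [legendre_expectationMap hφ hy', hy]
  have hfd : ∀ᶠ y in 𝓝 η, HasFDerivAt (legendre ν φ) (dotCLML (G y)) y := by
    filter_upwards [hright, hmem, hdiff, hleg.eventuallyEq_nhds] with y hy hy' hy'' hleg'
    have h1 := hasFDerivAt_dotProduct_self hy''.hasFDerivAt
    have h2 := (hasFDerivAt_logPartition hφ hy').comp y hy''.hasFDerivAt
    rw [hy] at h2
    refine ((h1.sub h2).congr_of_eventuallyEq hleg').congr_fderiv ?_
    -- Since `∇ψ (G y) = Λ (G y) = y`, the two terms containing the derivative of `G` cancel.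
    rw [dotCLML_apply, add_sub_cancel_right]
  refine ⟨?_, fun v w => ?_⟩
  · have : ContDiffAt ℝ (1 + 1) (legendre ν φ) η := by
      exact_mod_cast (contDiffAt_succ_iff_hasFDerivAt (n := 1)).2
        ⟨fun y => dotCLML (G y), eventually_iff_exists_mem.1 hfd,
          dotCLML.contDiff.contDiffAt.comp η (by exact_mod_cast hGsm)⟩
    rwa [one_add_one_eq_two] at this
  · have h : fderiv ℝ (legendre ν φ) =ᶠ[𝓝 η] dotCLML ∘ G := hfd.mono fun y hy => hy.fderiv
    have hd := (dotCLML (ι := ι)).hasFDerivAt.comp η hGd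
    rw [h.fderiv_eq, hd.fderiv]
    have hsymm : e.symm v = C⁻¹ *ᵥ v := rfl
    simp only [ContinuousLinearMap.comp_apply, ContinuousLinearEquiv.coe_coe, hsymm,
      dotCLML_apply, dotCLM_apply]
    rw [Matrix.dotProduct_mulVec, ← Matrix.mulVec_transpose, dotProduct_comm]
    have : C⁻¹ᵀ = C⁻¹ := by simpa using hCpd.inv.isHermitian.eq
    rw [this]

theorem distOfMean_expectationMap (hφ : Measurable φ)
    (hu : ∀ θ ∈ naturalParams ν φ, IsUnit (hessian (logPartition ν φ) θ)) {θ : ι → ℝ}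
    (hθ : θ ∈ naturalParams ν φ) :
    distOfMean ν φ (expectationMap ν φ θ) = expDist ν φ θ := by
  rw [distOfMean, (injOn_expectationMap hφ hu).leftInvOn_invFunOn hθ]

theorem posDef_covMatrix_distOfMean (hφ : Measurable φ)
    (hu : ∀ θ ∈ naturalParams ν φ, IsUnit (hessian (logPartition ν φ) θ)) {η : ι → ℝ}
    (hη : η ∈ expectationParams ν φ) : (covMatrix (distOfMean ν φ η) φ φ).PosDef := by
  obtain ⟨θ, hθ, rfl⟩ := hη
  rw [distOfMean_expectationMap hφ hu hθ]
  exact posDef_covMatrix hφ hu hθ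

theorem contDiffAt_legendre (hφ : Measurable φ)
    (hu : ∀ θ ∈ naturalParams ν φ, IsUnit (hessian (logPartition ν φ) θ)) {η : ι → ℝ}
    (hη : η ∈ expectationParams ν φ) : ContDiffAt ℝ 2 (legendre ν φ) η := by
  obtain ⟨θ, hθ, rfl⟩ := hη
  by_cases hν : ν = 0
  · have := isEmpty_of_isUnit_hessian hν (hu θ hθ)
    have hc : legendre ν φ = fun _ => legendre ν φ 0 :=
      funext fun y => congrArg _ (Subsingleton.elim y 0)
    rw [hc]
    exact contDiffAt_const
  · have : NeZero ν := ⟨hν⟩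
    exact (contDiffAt_legendre_expectationMap hφ hu hθ).1

theorem fderiv_fderiv_legendre (hφ : Measurable φ)
    (hu : ∀ θ ∈ naturalParams ν φ, IsUnit (hessian (logPartition ν φ) θ)) {η : ι → ℝ}
    (hη : η ∈ expectationParams ν φ) (v w : ι → ℝ) :
    fderiv ℝ (fderiv ℝ (legendre ν φ)) η v w =
      v ⬝ᵥ (covMatrix (distOfMean ν φ η) φ φ)⁻¹ *ᵥ w := by
  obtain ⟨θ, hθ, rfl⟩ := hη
  rw [distOfMean_expectationMap hφ hu hθ]
  by_cases hν : ν = 0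
  · have := isEmpty_of_isUnit_hessian hν (hu θ hθ)
    simp [Subsingleton.elim v 0]
  · have : NeZero ν := ⟨hν⟩
    exact (contDiffAt_legendre_expectationMap hφ hu hθ).2 v w

end Legendre

/-! ### Persistence of positive definiteness along a path. -/

theorem continuousOn_dotProduct_mulVec {T n : Type*} [TopologicalSpace T] [Fintype n] {S : Set T}
    {A : T → Matrix n n ℝ} {y : T → n → ℝ} (hA : ContinuousOn A S) (hy : ContinuousOn y S) :
    ContinuousOn (fun p => y p ⬝ᵥ A p *ᵥ y p) S := by
  have hA' : ∀ a b, ContinuousOn (fun p => A p a b) S := fun a b =>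
    (continuous_apply_apply a b).comp_continuousOn hA
  have hy' : ∀ a, ContinuousOn (fun p => y p a) S := fun a =>
    (continuous_apply a).comp_continuousOn hy
  exact continuousOn_finsetSum _ fun a _ => (hy' a).mul
    (continuousOn_finsetSum _ fun b _ => (hA' a b).mul (hy' b))

/-- A continuous path of symmetric non-singular matrices that starts at a positive definite matrix
ends at one. -/
theorem posDef_of_path {n : Type*} [Fintype n] {A : ℝ → Matrix n n ℝ}
    (hc : ContinuousOn A (Set.Icc 0 1)) (hsymm : ∀ t ∈ Set.Icc (0 : ℝ) 1, (A t).IsHermitian)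
    (h0 : (A 0).PosDef) (hker : ∀ t ∈ Set.Icc (0 : ℝ) 1, ∀ x, A t *ᵥ x = 0 → x = 0) :
    (A 1).PosDef := by
  classical
  refine Matrix.PosDef.of_dotProduct_mulVec_pos (hsymm 1 (by simp)) fun x hx => ?_
  rw [star_trivial]
  by_contra hneg
  let q : ℝ × (n → ℝ) → ℝ := fun p => p.2 ⬝ᵥ A p.1 *ᵥ p.2
  have hscale : ∀ (t c : ℝ) (y : n → ℝ), q (t, c • y) = c ^ 2 * q (t, y) := fun t c y => by
    simp only [q, Matrix.mulVec_smul, smul_dotProduct, dotProduct_smul, smul_eq_mul]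
    ring
  let S : Set (ℝ × (n → ℝ)) := Set.Icc 0 1 ×ˢ Metric.sphere 0 1
  have hS : IsCompact S := isCompact_Icc.prod (isCompact_sphere 0 1)
  have hq : ContinuousOn q S := continuousOn_dotProduct_mulVec
    (hc.comp continuous_fst.continuousOn fun p hp => hp.1) continuous_snd.continuousOn
  -- `K` collects the times and unit vectors at which the form fails to be positive. It is compact,
  -- so if the form fails at time `1` there is a first time of failure.
  let K := S ∩ q ⁻¹' Set.Iic 0
  have hK : IsCompact K := hS.of_isClosed_subset
    (hq.preimage_isClosed_of_isClosed hS.isClosed isClosed_Iic) Set.inter_subset_left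
  have hmemK : ∀ t ∈ Set.Icc (0 : ℝ) 1, ∀ y, y ≠ 0 → q (t, y) ≤ 0 → ∃ y', (t, y') ∈ K := by
    intro t ht y hy hle
    refine ⟨‖y‖⁻¹ • y, ⟨ht, ?_⟩, ?_⟩
    · simp [norm_smul, hy]
    · simp only [Set.mem_preimage, Set.mem_Iic, hscale]
      exact mul_nonpos_of_nonneg_of_nonpos (by positivity) hle
  obtain ⟨x', hx'⟩ := hmemK 1 (by simp) x hx (not_lt.1 hneg)
  obtain ⟨⟨t, z⟩, htz, hmin⟩ := hK.exists_isMinOn ⟨_, hx'⟩ continuous_fst.continuousOn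
  have ht : t ∈ Set.Icc (0 : ℝ) 1 := htz.1.1
  have hz : z ≠ 0 := by
    rintro rfl
    have := htz.1.2
    simp at this
  have hzle : z ⬝ᵥ A t *ᵥ z ≤ 0 := htz.2
  have ht0 : 0 < t := by
    refine lt_of_le_of_ne ht.1 fun h => ?_
    have := h0.dotProduct_mulVec_pos hz
    rw [star_trivial] at this
    rw [← h] at hzle
    exact this.not_ge hzle
  have hbefore : ∀ s ∈ Set.Ico 0 t, ∀ y, 0 ≤ y ⬝ᵥ A s *ᵥ y := by
    intro s hs y
    by_contra hlt
    have hy : y ≠ 0 := by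
      rintro rfl
      simp at hlt
    obtain ⟨y', hy'⟩ := hmemK s ⟨hs.1, hs.2.le.trans ht.2⟩ y hy (not_le.1 hlt).le
    exact (isMinOn_iff.1 hmin _ hy').not_gt hs.2
  -- The forms are nonnegative before the first failure, hence so is their limit at `t`. A vector on
  -- which a semidefinite form vanishes lies in its kernel, so `z` contradicts non-singularity.
  have hpsd : (A t).PosSemidef := by
    refine Matrix.PosSemidef.of_dotProduct_mulVec_nonneg (hsymm t ht) fun y => ?_
    rw [star_trivial]
    have hcont : ContinuousOn (fun s => y ⬝ᵥ A s *ᵥ y) (Set.Icc 0 1) :=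
      continuousOn_dotProduct_mulVec hc continuousOn_const
    have hlim : Tendsto (fun s => y ⬝ᵥ A s *ᵥ y) (𝓝[Set.Ico 0 t] t) (𝓝 (y ⬝ᵥ A t *ᵥ y)) :=
      (hcont t ht).mono fun s hs => ⟨hs.1, hs.2.le.trans ht.2⟩
    have : (𝓝[Set.Ico 0 t] t).NeBot := by
      rw [← mem_closure_iff_nhdsWithin_neBot, closure_Ico ht0.ne]
      exact ⟨ht.1, le_rfl⟩
    exact ge_of_tendsto hlim (eventually_mem_nhdsWithin.mono fun s hs => hbefore s hs y)
  have hzero : star z ⬝ᵥ A t *ᵥ z = 0 :=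
    le_antisymm hzle (hpsd.dotProduct_mulVec_nonneg z)
  exact hz (hker t ht z ((hpsd.dotProduct_mulVec_zero_iff z).1 hzero))

/-! ### Sums over incidences of vertices and factors. -/

section HypergraphSums

variable {V : Type*} [DecidableEq V] {H : Hypergraph V}

theorem sum_factor_const (i : V) (c : ℝ) :
    (∑ α : H.Factor, if i ∈ α.1 then c else 0) = H.degree i * c := by
  rw [Finset.sum_coe_sort H.hyperedges (fun α => if i ∈ α then c else 0), ← Finset.sum_filter,
    Finset.sum_const, nsmul_eq_mul, Hypergraph.degree]

variable [Fintype V]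

theorem sum_mem_eq_sum_dite (s : Finset V) (g : {i : V // i ∈ s} → ℝ) :
    ∑ j, g j = ∑ j : V, if h : j ∈ s then g ⟨j, h⟩ else 0 := by
  rw [← Finset.sum_subset (Finset.subset_univ s) fun j _ hj => dif_neg hj,
    Finset.sum_subtype s (p := fun j => j ∈ s) (fun _ => Iff.rfl)]
  exact Finset.sum_congr rfl fun j _ => by rw [dif_pos j.2]

theorem sum_factor_comm (g : ∀ α : H.Factor, {i : V // i ∈ α.1} → ℝ) :
    ∑ α, ∑ j, g α j = ∑ j : V, ∑ α : H.Factor, if h : j ∈ α.1 then g α ⟨j, h⟩ else 0 := by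
  rw [Finset.sum_comm]
  exact Finset.sum_congr rfl fun α _ => sum_mem_eq_sum_dite _ _

end HypergraphSums

/-! ### Block matrices of the factors and the action of the edge matrix. -/

section EdgeMatrix

variable {V : Type*} [DecidableEq V] {H : Hypergraph V} {r : V → ℕ} {s : H.Factor → ℕ}

/-- The index set of the components of the statistic of the factor `α`. -/
abbrev FactorIndex (r : V → ℕ) (s : H.Factor → ℕ) (α : H.Factor) : Type _ :=
  Fin (s α) ⊕ (Σ i : {i : V // i ∈ α.1}, Fin (r i))

/-- The index set of the coordinates `{η_⟨α⟩, η_i}`. -/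
abbrev CoordIndex (r : V → ℕ) (s : H.Factor → ℕ) : Type _ :=
  (Σ α : H.Factor, Fin (s α)) ⊕ (Σ i : V, Fin (r i))

/-- The position of the components of the statistic of `α` among all coordinates. -/
def factorEmb (r : V → ℕ) (s : H.Factor → ℕ) (α : H.Factor) :
    FactorIndex r s α → CoordIndex r s :=
  Sum.elim (fun k => Sum.inl ⟨α, k⟩) fun p => Sum.inr ⟨p.1, p.2⟩

/-- The position of the components of the statistic of the vertex `i` among all coordinates. -/
def vertexEmb (r : V → ℕ) (s : H.Factor → ℕ) (i : V) (k : Fin (r i)) : CoordIndex r s :=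
  Sum.inr ⟨i, k⟩

/-- The block diagonal matrix with the identity on `⟨α⟩` and the matrices `W i` on the vertices of
the factor `α`. -/
def vertexBlocks (s : H.Factor → ℕ) (W : ∀ i, Matrix (Fin (r i)) (Fin (r i)) ℝ) (α : H.Factor) :
    Matrix (FactorIndex r s α) (FactorIndex r s α) ℝ :=
  Matrix.fromBlocks 1 0 0 (Matrix.blockDiagonal' fun i : {i : V // i ∈ α.1} => W i)

theorem vertexBlocks_mulVec_inl (W : ∀ i, Matrix (Fin (r i)) (Fin (r i)) ℝ) (α : H.Factor)
    (y : FactorIndex r s α → ℝ) (k : Fin (s α)) :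
    (vertexBlocks s W α *ᵥ y) (Sum.inl k) = y (Sum.inl k) := by
  simp [vertexBlocks, Matrix.mulVec, dotProduct, Matrix.one_apply]

theorem vertexBlocks_mulVec_inr (W : ∀ i, Matrix (Fin (r i)) (Fin (r i)) ℝ) (α : H.Factor)
    (y : FactorIndex r s α → ℝ) (i : {i : V // i ∈ α.1}) (k : Fin (r i)) :
    (vertexBlocks s W α *ᵥ y) (Sum.inr ⟨i, k⟩) = (W i *ᵥ fun l => y (Sum.inr ⟨i, l⟩)) k := by
  simp only [vertexBlocks, Matrix.mulVec, dotProduct, Fintype.sum_sum_type, Fintype.sum_sigma,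
    Matrix.fromBlocks_apply₂₁, Matrix.fromBlocks_apply₂₂, Matrix.zero_apply, zero_mul,
    Finset.sum_const_zero, zero_add]
  rw [Finset.sum_eq_single i]
  · simp [Matrix.blockDiagonal'_apply_eq]
  · intro j _ hj
    simp [Matrix.blockDiagonal'_apply_ne _ _ _ hj.symm]
  · simp

theorem dotProduct_vertexBlocks_mulVec (W : ∀ i, Matrix (Fin (r i)) (Fin (r i)) ℝ) (α : H.Factor)
    (y : FactorIndex r s α → ℝ) :
    y ⬝ᵥ vertexBlocks s W α *ᵥ y = ∑ k, y (Sum.inl k) ^ 2 + ∑ i : {i : V // i ∈ α.1},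
      (fun l => y (Sum.inr ⟨i, l⟩)) ⬝ᵥ W i *ᵥ fun l => y (Sum.inr ⟨i, l⟩) := by
  rw [dotProduct, Fintype.sum_sum_type, Fintype.sum_sigma]
  simp only [vertexBlocks_mulVec_inl, vertexBlocks_mulVec_inr, dotProduct, sq]

theorem vertexBlocks_inv {W : ∀ i, Matrix (Fin (r i)) (Fin (r i)) ℝ} (hW : ∀ i, IsUnit (W i).det)
    (α : H.Factor) : (vertexBlocks s W α)⁻¹ = vertexBlocks s (fun i => (W i)⁻¹) α := by
  refine Matrix.inv_eq_right_inv ?_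
  simp only [vertexBlocks, Matrix.fromBlocks_multiply, mul_one, add_zero, zero_add, Matrix.mul_one,
    Matrix.mul_zero, Matrix.zero_mul, ← Matrix.blockDiagonal'_mul,
    Matrix.mul_nonsing_inv _ (hW _)]
  exact (congrArg (Matrix.fromBlocks 1 0 0) Matrix.blockDiagonal'_one).trans Matrix.fromBlocks_one

theorem posDef_vertexBlocks {W : ∀ i, Matrix (Fin (r i)) (Fin (r i)) ℝ} (hW : ∀ i, (W i).PosDef)
    (α : H.Factor) : (vertexBlocks s W α).PosDef := by
  refine Matrix.PosDef.of_dotProduct_mulVec_pos ?_ fun y hy => ?_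
  · have hW' : ∀ i, (W i)ᵀ = W i := fun i => by simpa using (hW i).isHermitian.eq
    simp [Matrix.IsHermitian, vertexBlocks, Matrix.fromBlocks_transpose,
      Matrix.blockDiagonal'_transpose, hW']
  · have hnn : ∀ i : {i : V // i ∈ α.1},
        0 ≤ (fun l => y (Sum.inr ⟨i, l⟩)) ⬝ᵥ W i *ᵥ fun l => y (Sum.inr ⟨i, l⟩) := fun i => by
      simpa using (hW i).posSemidef.dotProduct_mulVec_nonneg fun l => y (Sum.inr ⟨i, l⟩)
    rw [star_trivial, dotProduct_vertexBlocks_mulVec]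
    obtain ⟨p, hp⟩ := Function.ne_iff.1 hy
    rcases p with k | ⟨i, k⟩
    · refine add_pos_of_pos_of_nonneg ?_ (Finset.sum_nonneg fun i _ => hnn i)
      exact Finset.sum_pos' (fun _ _ => sq_nonneg _)
        ⟨k, Finset.mem_univ k, by have : y (Sum.inl k) ≠ 0 := hp; positivity⟩
    · refine add_pos_of_nonneg_of_pos (Finset.sum_nonneg fun _ _ => sq_nonneg _) ?_
      refine Finset.sum_pos' (fun i _ => hnn i) ⟨i, Finset.mem_univ i, ?_⟩
      have hne : (fun l => y (Sum.inr ⟨i, l⟩)) ≠ 0 := Function.ne_iff.2 ⟨k, hp⟩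
      simpa using (hW i).dotProduct_mulVec_pos hne

/-- The weights `u^α_{i → j} = W_j⁻¹ C^α_{ji}` given by covariance matrices `C α` and `W i`. -/
def covWeight (C : ∀ α, Matrix (FactorIndex r s α) (FactorIndex r s α) ℝ)
    (W : ∀ i, Matrix (Fin (r i)) (Fin (r i)) ℝ) (α : H.Factor) (i j : {i : V // i ∈ α.1}) :
    Matrix (Fin (r j)) (Fin (r i)) ℝ :=
  (W j)⁻¹ * Matrix.of fun k l => C α (Sum.inr ⟨j, k⟩) (Sum.inr ⟨i, l⟩)

variable [Fintype V]

-- The action on real vectors, regrouped by the source vertex `j` and then by the factors `β`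
-- containing `j`. The inner sum, over all `β ∋ j` except `α`, is the one that the stationarity
-- equations evaluate.
open Classical in
theorem edgeMatrix_mulVec_ofReal
    (u : ∀ (α : H.Factor) (i j : {i : V // i ∈ α.1}), Matrix (Fin (r j)) (Fin (r i)) ℝ)
    (f : ∀ (α : H.Factor) (i : {i : V // i ∈ α.1}), Fin (r i) → ℝ)
    (α : H.Factor) (i : {i : V // i ∈ α.1}) (k : Fin (r i)) :
    (edgeMatrix (fun α i j => (u α i j).map (fun t : ℝ => (t : ℂ))) *ᵥ
        fun q : (Σ e : H.DirEdge, Fin (r e.2)) => (f q.1.1 q.1.2 q.2 : ℂ)) ⟨⟨α, i⟩, k⟩ =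
      ((∑ j : {j : V // j ∈ α.1}, if j = i then 0 else ∑ l, u α j i k l *
        ∑ β : H.Factor, if h : (j : V) ∈ β.1 then (if β = α then 0 else f β ⟨j, h⟩ l) else 0 : ℝ)
        : ℂ) := by
  have hreal : (edgeMatrix (fun α i j => (u α i j).map (fun t : ℝ => (t : ℂ))) *ᵥ
        fun q : (Σ e : H.DirEdge, Fin (r e.2)) => (f q.1.1 q.1.2 q.2 : ℂ)) ⟨⟨α, i⟩, k⟩ =
      ((∑ q : (Σ e : H.DirEdge, Fin (r e.2)), (if h : H.Feeds q.1 ⟨α, i⟩ then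
        u α ⟨q.1.2, h.1⟩ i k q.2 else 0) * f q.1.1 q.1.2 q.2 : ℝ) : ℂ) := by
    rw [Complex.ofReal_sum]
    refine Finset.sum_congr rfl fun q _ => ?_
    simp only [edgeMatrix, Matrix.of_apply, Complex.ofReal_mul]
    split_ifs <;> simp
  rw [hreal]
  congr 1
  rw [Fintype.sum_sigma, Fintype.sum_sigma, sum_factor_comm, sum_mem_eq_sum_dite]
  refine Finset.sum_congr rfl fun j _ => ?_
  by_cases hj : j ∈ α.1
  · rw [dif_pos hj]
    by_cases hji : (⟨j, hj⟩ : {j : V // j ∈ α.1}) = i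
    · rw [if_pos hji]
      refine Finset.sum_eq_zero fun β _ => ?_
      split_ifs with h
      · refine Finset.sum_eq_zero fun l _ => ?_
        rw [dif_neg, zero_mul]
        rintro ⟨-, h', -⟩
        exact h' (congrArg Subtype.val hji)
      · rfl
    · rw [if_neg hji]
      simp only [Finset.mul_sum]
      rw [Finset.sum_comm]
      refine Finset.sum_congr rfl fun β _ => ?_
      by_cases hβ : j ∈ β.1
      · simp only [dif_pos hβ]
        refine Finset.sum_congr rfl fun l _ => ?_
        by_cases hβα : β = α
        · rw [dif_neg (fun h => h.2.2 hβα), if_pos hβα, zero_mul, mul_zero]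
        · rw [dif_pos ⟨hj, fun h => hji (Subtype.ext h), hβα⟩, if_neg hβα]
      · simp [dif_neg hβ]
  · rw [dif_neg hj]
    refine Finset.sum_eq_zero fun β _ => ?_
    split_ifs with h
    · exact Finset.sum_eq_zero fun l _ => by rw [dif_neg fun h => hj h.1, zero_mul]
    · rfl

end EdgeMatrix

/-! ### Non-singularity of the deformed Bethe matrices. -/

section Kernel

variable {V : Type*} [DecidableEq V] {H : Hypergraph V} {r : V → ℕ} {s : H.Factor → ℕ}
  {C : ∀ α, Matrix (FactorIndex r s α) (FactorIndex r s α) ℝ}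
  {W : ∀ i, Matrix (Fin (r i)) (Fin (r i)) ℝ}

/-- The segment from the block diagonal matrix `vertexBlocks s W α` (at `t = 0`) to `C α` (at
`t = 1`): it multiplies the blocks of `C α` that belong to two different vertices by `t`. -/
def scaledCov (C : ∀ α, Matrix (FactorIndex r s α) (FactorIndex r s α) ℝ)
    (W : ∀ i, Matrix (Fin (r i)) (Fin (r i)) ℝ) (t : ℝ) (α : H.Factor) :
    Matrix (FactorIndex r s α) (FactorIndex r s α) ℝ :=
  t • C α + (1 - t) • vertexBlocks s W α

/-- A convex combination of positive definite matrices; `t = 0` is separate because the first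
summand is then zero. -/
theorem posDef_scaledCov (hC : ∀ α, (C α).PosDef) (hW : ∀ i, (W i).PosDef) {t : ℝ}
    (ht : t ∈ Set.Icc (0 : ℝ) 1) (α : H.Factor) : (scaledCov C W t α).PosDef := by
  rcases ht.1.eq_or_lt with rfl | h
  · simpa [scaledCov] using posDef_vertexBlocks hW α
  · exact ((hC α).smul h).add_posSemidef
      ((posDef_vertexBlocks hW α).posSemidef.smul (sub_nonneg.2 ht.2))

theorem continuousOn_inv_scaledCov (hC : ∀ α, (C α).PosDef) (hW : ∀ i, (W i).PosDef)
    (α : H.Factor) : ContinuousOn (fun t => (scaledCov C W t α)⁻¹) (Set.Icc 0 1) := by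
  have hc : Continuous fun t => scaledCov C W t α := by
    unfold scaledCov
    fun_prop
  simp only [Matrix.inv_def, Ring.inverse_eq_inv']
  have hdet : ContinuousOn (fun t => (scaledCov C W t α).det⁻¹) (Set.Icc 0 1) :=
    hc.matrix_det.continuousOn.inv₀ fun t ht => (posDef_scaledCov hC hW ht α).det_pos.ne'
  exact hdet.smul hc.matrix_adjugate.continuousOn

variable [Fintype V]

/-- A solution `y α`, `α ∈ F`, of the local equations turns into an eigenvector of the edge matrix
for the eigenvalue `1 / t`. -/
theorem eq_zero_of_stationary (hW : ∀ i, (W i).PosDef)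
    (hCW : ∀ α (i : {i : V // i ∈ α.1}) k l, C α (Sum.inr ⟨i, k⟩) (Sum.inr ⟨i, l⟩) = W i k l)
    (hspec : ∀ z : ℂ, Module.End.HasEigenvalue (Matrix.toLin' (edgeMatrix fun α i j =>
        (covWeight C W α i j).map (fun t : ℝ => (t : ℂ)))) z → ¬ ∃ t : ℝ, 1 ≤ t ∧ z = (t : ℂ))
    {t : ℝ} (ht : t ∈ Set.Icc (0 : ℝ) 1) {x : CoordIndex r s → ℝ}
    {y : ∀ α, FactorIndex r s α → ℝ}
    (hxy : ∀ α, scaledCov C W t α *ᵥ y α = x ∘ factorEmb r s α)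
    (hinl : ∀ α k, y α (Sum.inl k) = 0)
    (hinr : ∀ i k, (∑ β : H.Factor, if h : i ∈ β.1 then y β (Sum.inr ⟨⟨i, h⟩, k⟩) else 0) +
      (1 - (H.degree i : ℝ)) * ((W i)⁻¹ *ᵥ (x ∘ vertexEmb r s i)) k = 0) : x = 0 := by
  classical
  have hWdet : ∀ i, IsUnit (W i).det := fun i =>
    (Matrix.isUnit_iff_isUnit_det _).1 (hW i).isUnit
  set z : ∀ i, Fin (r i) → ℝ := fun i => (W i)⁻¹ *ᵥ (x ∘ vertexEmb r s i) with hz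
  let f : ∀ (α : H.Factor) (i : {i : V // i ∈ α.1}), Fin (r i) → ℝ := fun α i k =>
    z i k - y α (Sum.inr ⟨i, k⟩)
  have hWz : ∀ i, W i *ᵥ z i = x ∘ vertexEmb r s i := fun i => by
    rw [hz, Matrix.mulVec_mulVec, (W i).mul_nonsing_inv (hWdet i), Matrix.one_mulVec]
  -- The diagonal block at `i` is `W i` at both ends of the segment, hence for every `t`. The blocks
  -- against `⟨α⟩` act on zero by `hinl`. Only the blocks between different vertices keep the factor
  -- `t`.
  have hrow : ∀ α (i : {i : V // i ∈ α.1}) (k : Fin (r i)), x (vertexEmb r s i k) =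
      (W i *ᵥ fun l => y α (Sum.inr ⟨i, l⟩)) k + t * ∑ j : {j : V // j ∈ α.1}, if j = i then 0
        else ∑ l, C α (Sum.inr ⟨i, k⟩) (Sum.inr ⟨j, l⟩) * y α (Sum.inr ⟨j, l⟩) := by
    intro α i k
    have h := congrFun (hxy α) (Sum.inr ⟨i, k⟩)
    have hx : (x ∘ factorEmb r s α) (Sum.inr ⟨i, k⟩) = x (vertexEmb r s i k) := rfl
    have hCy : (C α *ᵥ y α) (Sum.inr ⟨i, k⟩) = (W i *ᵥ fun l => y α (Sum.inr ⟨i, l⟩)) k +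
        ∑ j : {j : V // j ∈ α.1}, if j = i then 0
          else ∑ l, C α (Sum.inr ⟨i, k⟩) (Sum.inr ⟨j, l⟩) * y α (Sum.inr ⟨j, l⟩) := by
      simp only [Matrix.mulVec, dotProduct, Fintype.sum_sum_type, Fintype.sum_sigma, hinl,
        mul_zero, Finset.sum_const_zero, zero_add, ← hCW α i]
      rw [← Finset.add_sum_erase _ _ (Finset.mem_univ i),
        ← Finset.add_sum_erase (a := i) (s := Finset.univ) (f := fun j => if j = i then (0 : ℝ)
          else ∑ l, C α (Sum.inr ⟨i, k⟩) (Sum.inr ⟨j, l⟩) * y α (Sum.inr ⟨j, l⟩))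
          (Finset.mem_univ i), if_pos rfl, zero_add]
      congr 1
      exact Finset.sum_congr rfl fun j hj => (if_neg (Finset.ne_of_mem_erase hj)).symm
    rw [hx, scaledCov, Matrix.add_mulVec, Matrix.smul_mulVec, Matrix.smul_mulVec, Pi.add_apply,
      Pi.smul_apply, Pi.smul_apply, vertexBlocks_mulVec_inr, hCy] at h
    rw [← h, smul_eq_mul, smul_eq_mul]
    ring
  have hlocal : ∀ α (i : {i : V // i ∈ α.1}) (k : Fin (r i)), f α i k =
      t * ∑ j : {j : V // j ∈ α.1}, if j = i then 0
        else ∑ l, covWeight C W α j i k l * y α (Sum.inr ⟨j, l⟩) := by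
    intro α i k
    have hvec : z i = (fun l => y α (Sum.inr ⟨i, l⟩)) + (W i)⁻¹ *ᵥ fun k =>
        t * ∑ j : {j : V // j ∈ α.1}, if j = i then 0
          else ∑ l, C α (Sum.inr ⟨i, k⟩) (Sum.inr ⟨j, l⟩) * y α (Sum.inr ⟨j, l⟩) := by
      have h1 : x ∘ vertexEmb r s i = (W i *ᵥ fun l => y α (Sum.inr ⟨i, l⟩)) + fun k =>
          t * ∑ j : {j : V // j ∈ α.1}, if j = i then 0
            else ∑ l, C α (Sum.inr ⟨i, k⟩) (Sum.inr ⟨j, l⟩) * y α (Sum.inr ⟨j, l⟩) :=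
        funext fun k => hrow α i k
      simp only [hz]
      rw [h1, Matrix.mulVec_add, Matrix.mulVec_mulVec, (W i).nonsing_inv_mul (hWdet i),
        Matrix.one_mulVec]
    have h2 := congrFun hvec k
    simp only [f, h2, Pi.add_apply, add_sub_cancel_left]
    simp only [Matrix.mulVec, dotProduct, covWeight, Matrix.mul_apply, Matrix.of_apply,
      Finset.mul_sum]
    rw [Finset.sum_comm]
    refine Finset.sum_congr rfl fun j _ => ?_
    split_ifs with hji
    · simp
    · simp only [Finset.mul_sum, Finset.sum_mul]
      rw [Finset.sum_comm]
      refine Finset.sum_congr rfl fun l _ => Finset.sum_congr rfl fun m _ => by ring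
  -- The sum is `d_i z_i - ∑ y`, and stationarity at `i` says `∑ y = (d_i - 1) z_i`.
  have hsum : ∀ i k, (∑ β : H.Factor, if h : i ∈ β.1 then f β ⟨i, h⟩ k else 0) = z i k := by
    intro i k
    have h1 : (∑ β : H.Factor, if h : i ∈ β.1 then f β ⟨i, h⟩ k else 0) =
        (∑ β : H.Factor, if i ∈ β.1 then z i k else 0) -
          ∑ β : H.Factor, if h : i ∈ β.1 then y β (Sum.inr ⟨⟨i, h⟩, k⟩) else 0 := by
      rw [← Finset.sum_sub_distrib]
      refine Finset.sum_congr rfl fun β _ => ?_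
      split_ifs
      · rfl
      · simp
    rw [h1, sum_factor_const]
    have := hinr i k
    change _ + (1 - (H.degree i : ℝ)) * z i k = 0 at this
    linarith
  -- Leaving out `β = α` from the previous sum gives `z_j - f (α → j)`, which is the component of `y
  -- α` at `j`. Inserted in `hlocal`, this yields `f = t M(u) f`.
  have hothers : ∀ α (j : {j : V // j ∈ α.1}) (l : Fin (r j)), (∑ β : H.Factor,
      if h : (j : V) ∈ β.1 then (if β = α then 0 else f β ⟨j, h⟩ l) else 0) =
        y α (Sum.inr ⟨j, l⟩) := by
    intro α j l
    have h1 : y α (Sum.inr ⟨j, l⟩) = z j l - f α j l := by simp [f]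
    rw [h1, ← hsum, ← Finset.add_sum_erase _ _ (Finset.mem_univ α),
      ← Finset.add_sum_erase (a := α) (s := Finset.univ)
        (f := fun β : H.Factor => if h : (j : V) ∈ β.1 then f β ⟨j, h⟩ l else 0)
        (Finset.mem_univ α), dif_pos j.2, dif_pos j.2, if_pos rfl, zero_add, add_sub_cancel_left]
    exact Finset.sum_congr rfl fun β hβ => by simp only [if_neg (Finset.ne_of_mem_erase hβ)]
  let fc : (Σ e : H.DirEdge, Fin (r e.2)) → ℂ := fun q => (f q.1.1 q.1.2 q.2 : ℂ)
  have heig : ∀ q, fc q = (t : ℂ) * (edgeMatrix (fun α i j =>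
      (covWeight C W α i j).map (fun t : ℝ => (t : ℂ))) *ᵥ fc) q := by
    rintro ⟨⟨α, i⟩, k⟩
    rw [edgeMatrix_mulVec_ofReal (covWeight C W) f α i k, ← Complex.ofReal_mul]
    simp only [hothers, fc, hlocal α i k]
  have hf : fc = 0 := by
    by_contra hne
    have ht0 : t ≠ 0 := by
      rintro rfl
      exact hne (funext fun q => by rw [heig q]; simp)
    refine hspec ((t⁻¹ : ℝ) : ℂ) ?_ ⟨t⁻¹, (one_le_inv₀ (lt_of_le_of_ne ht.1 ht0.symm)).2 ht.2, rfl⟩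
    refine Module.End.hasEigenvalue_of_hasEigenvector (x := fc)
      ⟨Module.End.mem_eigenspace_iff.2 ?_, hne⟩
    ext q
    rw [Matrix.toLin'_apply, Pi.smul_apply, smul_eq_mul]
    conv_rhs => rw [heig q]
    rw [← mul_assoc, ← Complex.ofReal_mul, inv_mul_cancel₀ ht0, Complex.ofReal_one, one_mul]
  have hf' : ∀ α (i : {i : V // i ∈ α.1}) k, f α i k = 0 := fun α i k =>
    Complex.ofReal_eq_zero.1 (congrFun hf ⟨⟨α, i⟩, k⟩)
  have hz0 : ∀ i, z i = 0 := fun i => funext fun k => by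
    rw [← hsum i k]
    exact Finset.sum_eq_zero fun β _ => by split_ifs <;> simp [hf']
  -- With `f = 0` and `z = 0` the vertex components of `y α` vanish; the others do by `hinl`.
  have hy0 : ∀ α, y α = 0 := fun α => by
    ext p
    rcases p with k | ⟨j, l⟩
    · exact hinl α k
    · have := hf' α j l
      simpa [f, hz0] using this
  ext p
  rcases p with ⟨α, k⟩ | ⟨i, k⟩
  · have := congrFun (hxy α) (Sum.inl k)
    rw [hy0, Matrix.mulVec_zero] at this
    exact this.symm
  · have := congrFun (hWz i) k
    rw [hz0, Matrix.mulVec_zero] at this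
    exact this.symm

/-- The matrix of the bilinear form of `A` pulled back along `x ↦ x ∘ σ`. -/
def pullback {m n : Type*} [Fintype m] [DecidableEq n] (σ : m → n) (A : Matrix m m ℝ) :
    Matrix n n ℝ :=
  ((1 : Matrix n n ℝ).submatrix σ id)ᵀ * A * (1 : Matrix n n ℝ).submatrix σ id

theorem dotProduct_pullback_mulVec {m n : Type*} [Fintype m] [Fintype n] [DecidableEq n]
    (σ : m → n) (A : Matrix m m ℝ) (w x : n → ℝ) :
    w ⬝ᵥ pullback σ A *ᵥ x = (w ∘ σ) ⬝ᵥ A *ᵥ (x ∘ σ) := by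
  have h : ∀ w : n → ℝ, (1 : Matrix n n ℝ).submatrix σ id *ᵥ w = w ∘ σ := fun w => by
    ext p
    simp [Matrix.mulVec, dotProduct, Matrix.one_apply]
  rw [pullback, ← Matrix.mulVec_mulVec, ← Matrix.mulVec_mulVec, Matrix.dotProduct_mulVec,
    Matrix.vecMul_transpose, h, h]

theorem isHermitian_pullback {m n : Type*} [Fintype m] [DecidableEq n] (σ : m → n)
    {A : Matrix m m ℝ} (hA : A.IsHermitian) : (pullback σ A).IsHermitian := by
  have := Matrix.isHermitian_conjTranspose_mul_mul ((1 : Matrix n n ℝ).submatrix σ id) hA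
  rwa [Matrix.conjTranspose_eq_transpose_of_trivial] at this

theorem continuous_pullback {m n : Type*} [Fintype m] [DecidableEq n] (σ : m → n) :
    Continuous fun A : Matrix m m ℝ => pullback σ A :=
  (continuous_const.matrix_mul continuous_id).matrix_mul continuous_const

/-- The matrix with blocks `(C α)⁻¹` on the coordinates of the factors, corrected by
`(1 - d_i) (W i)⁻¹` on those of the vertices. -/
def betheMatrix (C : ∀ α, Matrix (FactorIndex r s α) (FactorIndex r s α) ℝ)
    (W : ∀ i, Matrix (Fin (r i)) (Fin (r i)) ℝ) : Matrix (CoordIndex r s) (CoordIndex r s) ℝ :=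
  ∑ α, pullback (factorEmb r s α) (C α)⁻¹ +
    ∑ i, (1 - (H.degree i : ℝ)) • pullback (vertexEmb r s i) (W i)⁻¹

theorem dotProduct_betheMatrix_mulVec (w x : CoordIndex r s → ℝ) :
    w ⬝ᵥ betheMatrix C W *ᵥ x =
      (∑ α, (w ∘ factorEmb r s α) ⬝ᵥ (C α)⁻¹ *ᵥ (x ∘ factorEmb r s α)) +
      ∑ i, (1 - (H.degree i : ℝ)) *
        ((w ∘ vertexEmb r s i) ⬝ᵥ (W i)⁻¹ *ᵥ (x ∘ vertexEmb r s i)) := by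
  simp only [betheMatrix, Matrix.add_mulVec, Matrix.sum_mulVec, dotProduct_add, dotProduct_sum,
    Matrix.smul_mulVec, dotProduct_smul, dotProduct_pullback_mulVec, smul_eq_mul]

theorem isHermitian_betheMatrix (hC : ∀ α, (C α).IsHermitian) (hW : ∀ i, (W i).IsHermitian) :
    (betheMatrix C W).IsHermitian := by
  unfold betheMatrix
  refine Matrix.IsHermitian.add ?_ ?_
  · exact isSelfAdjoint_sum _ fun α _ => isHermitian_pullback _ (hC α).inv
  · exact isSelfAdjoint_sum _ fun i _ =>
      IsSelfAdjoint.smul (IsSelfAdjoint.all _) (isHermitian_pullback _ (hW i).inv)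

/-- The kernel equation, read in the coordinates `η_⟨α⟩` and `η_i`, is the system solved in
`eq_zero_of_stationary`, with `y α = (C_t α)⁻¹ x_α`. -/
theorem eq_zero_of_betheMatrix_mulVec_eq_zero (hC : ∀ α, (C α).PosDef) (hW : ∀ i, (W i).PosDef)
    (hCW : ∀ α (i : {i : V // i ∈ α.1}) k l, C α (Sum.inr ⟨i, k⟩) (Sum.inr ⟨i, l⟩) = W i k l)
    (hspec : ∀ z : ℂ, Module.End.HasEigenvalue (Matrix.toLin' (edgeMatrix fun α i j =>
        (covWeight C W α i j).map (fun t : ℝ => (t : ℂ)))) z → ¬ ∃ t : ℝ, 1 ≤ t ∧ z = (t : ℂ))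
    {t : ℝ} (ht : t ∈ Set.Icc (0 : ℝ) 1) {x : CoordIndex r s → ℝ}
    (hx : betheMatrix (scaledCov C W t) W *ᵥ x = 0) : x = 0 := by
  let y : ∀ α, FactorIndex r s α → ℝ := fun α => (scaledCov C W t α)⁻¹ *ᵥ (x ∘ factorEmb r s α)
  -- `R` is the product of the Bethe matrix with `x`, written out by coordinates. It is identified
  -- by pairing with test vectors `w`; the choice `w = R` then gives `⟨R, R⟩ = 0`.
  let R : CoordIndex r s → ℝ := Sum.elim (fun p => y p.1 (Sum.inl p.2)) fun p =>
    (∑ β : H.Factor, if h : p.1 ∈ β.1 then y β (Sum.inr ⟨⟨p.1, h⟩, p.2⟩) else 0) +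
      (1 - (H.degree p.1 : ℝ)) * ((W p.1)⁻¹ *ᵥ (x ∘ vertexEmb r s p.1)) p.2
  have hweak : ∀ w : CoordIndex r s → ℝ,
      w ⬝ᵥ betheMatrix (scaledCov C W t) W *ᵥ x = w ⬝ᵥ R := by
    intro w
    have h1 : ∑ α, (w ∘ factorEmb r s α) ⬝ᵥ y α =
        ∑ α, ∑ k, w (Sum.inl ⟨α, k⟩) * y α (Sum.inl k) + ∑ i : V, ∑ k, w (Sum.inr ⟨i, k⟩) *
          ∑ β : H.Factor, if h : i ∈ β.1 then y β (Sum.inr ⟨⟨i, h⟩, k⟩) else 0 := by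
      simp only [dotProduct, Fintype.sum_sum_type, Fintype.sum_sigma, Finset.sum_add_distrib]
      rw [sum_factor_comm]
      congr 1
      refine Finset.sum_congr rfl fun i _ => ?_
      simp only [Finset.mul_sum]
      rw [Finset.sum_comm]
      refine Finset.sum_congr rfl fun β _ => ?_
      split_ifs
      · rfl
      · simp
    rw [dotProduct_betheMatrix_mulVec, h1, dotProduct, Fintype.sum_sum_type, Fintype.sum_sigma,
      Fintype.sum_sigma, add_assoc, ← Finset.sum_add_distrib]
    congr 1
    refine Finset.sum_congr rfl fun i _ => ?_
    rw [dotProduct, Finset.mul_sum, ← Finset.sum_add_distrib]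
    refine Finset.sum_congr rfl fun k _ => ?_
    simp only [R, Sum.elim_inr, Function.comp_apply, vertexEmb]
    ring
  have hR : R = 0 := by
    have := hweak R
    rw [hx, dotProduct_zero] at this
    exact dotProduct_self_eq_zero.1 this.symm
  refine eq_zero_of_stationary hW hCW hspec ht (x := x) (y := y) (fun α => ?_)
    (fun α k => congrFun hR (Sum.inl ⟨α, k⟩)) fun i k => congrFun hR (Sum.inr ⟨i, k⟩)
  rw [Matrix.mulVec_mulVec, Matrix.mul_nonsing_inv _
    (posDef_scaledCov hC hW ht α).det_pos.ne'.isUnit, Matrix.one_mulVec]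

/-- Each of the `d_i` factors containing `i` contributes the form of `(W i)⁻¹`, and the correction
`1 - d_i` leaves it exactly once. The form is a sum of squares plus these vertex forms. -/
theorem posDef_betheMatrix_vertexBlocks (hW : ∀ i, (W i).PosDef) :
    (betheMatrix (vertexBlocks s W) W).PosDef := by
  refine Matrix.PosDef.of_dotProduct_mulVec_pos (isHermitian_betheMatrix
    (fun α => (posDef_vertexBlocks hW α).isHermitian) fun i => (hW i).isHermitian) fun x hx => ?_
  let Q : V → ℝ := fun i => (x ∘ vertexEmb r s i) ⬝ᵥ (W i)⁻¹ *ᵥ (x ∘ vertexEmb r s i)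
  have hform : x ⬝ᵥ betheMatrix (vertexBlocks s W) W *ᵥ x =
      ∑ α, ∑ k, x (Sum.inl ⟨α, k⟩) ^ 2 + ∑ i, Q i := by
    have h1 : ∀ α, (x ∘ factorEmb r s α) ⬝ᵥ (vertexBlocks s W α)⁻¹ *ᵥ (x ∘ factorEmb r s α) =
        ∑ k, x (Sum.inl ⟨α, k⟩) ^ 2 + ∑ i : {i : V // i ∈ α.1}, Q i := fun α => by
      rw [vertexBlocks_inv (fun i => (hW i).det_pos.ne'.isUnit), dotProduct_vertexBlocks_mulVec]
      rfl
    rw [dotProduct_betheMatrix_mulVec]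
    simp only [h1, Finset.sum_add_distrib]
    rw [sum_factor_comm (H := H) (fun α (i : {i : V // i ∈ α.1}) => Q i), add_assoc, ← Finset.sum_add_distrib]
    congr 1
    refine Finset.sum_congr rfl fun i _ => ?_
    simp only [dite_eq_ite, sum_factor_const]
    change _ + (1 - (H.degree i : ℝ)) * Q i = Q i
    ring
  have hQ : ∀ i, 0 ≤ Q i := fun i => by
    simpa using (hW i).inv.posSemidef.dotProduct_mulVec_nonneg (x ∘ vertexEmb r s i)
  rw [star_trivial, hform]
  obtain ⟨p, hp⟩ := Function.ne_iff.1 hx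
  rcases p with ⟨α, k⟩ | ⟨i, k⟩
  · refine add_pos_of_pos_of_nonneg ?_ (Finset.sum_nonneg fun i _ => hQ i)
    refine Finset.sum_pos' (fun _ _ => Finset.sum_nonneg fun _ _ => sq_nonneg _)
      ⟨α, Finset.mem_univ α, Finset.sum_pos' (fun _ _ => sq_nonneg _) ⟨k, Finset.mem_univ k, ?_⟩⟩
    have : x (Sum.inl ⟨α, k⟩) ≠ 0 := hp
    positivity
  · refine add_pos_of_nonneg_of_pos
      (Finset.sum_nonneg fun _ _ => Finset.sum_nonneg fun _ _ => sq_nonneg _) ?_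
    refine Finset.sum_pos' (fun i _ => hQ i) ⟨i, Finset.mem_univ i, ?_⟩
    have hne : x ∘ vertexEmb r s i ≠ 0 := Function.ne_iff.2 ⟨k, hp⟩
    simpa using (hW i).inv.dotProduct_mulVec_pos hne

/-- If the edge matrix of the weights has no real eigenvalue `≥ 1`, the Bethe matrix is positive
definite. -/
theorem posDef_betheMatrix (hC : ∀ α, (C α).PosDef) (hW : ∀ i, (W i).PosDef)
    (hCW : ∀ α (i : {i : V // i ∈ α.1}) k l, C α (Sum.inr ⟨i, k⟩) (Sum.inr ⟨i, l⟩) = W i k l)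
    (hspec : ∀ z : ℂ, Module.End.HasEigenvalue (Matrix.toLin' (edgeMatrix fun α i j =>
        (covWeight C W α i j).map (fun t : ℝ => (t : ℂ)))) z → ¬ ∃ t : ℝ, 1 ≤ t ∧ z = (t : ℂ)) :
    (betheMatrix C W).PosDef := by
  have hzero : scaledCov C W 0 = vertexBlocks s W := by
    ext1 α
    simp [scaledCov]
  have hone : scaledCov C W 1 = C := by
    ext1 α
    simp [scaledCov]
  have := posDef_of_path (A := fun t => betheMatrix (scaledCov C W t) W)
    ((continuousOn_finsetSum _ fun α _ => (continuous_pullback _).comp_continuousOn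
      (continuousOn_inv_scaledCov hC hW α)).add continuousOn_const)
    (fun t ht => isHermitian_betheMatrix (fun α => (posDef_scaledCov hC hW ht α).isHermitian)
      fun i => (hW i).isHermitian)
    (by simpa only [hzero] using posDef_betheMatrix_vertexBlocks hW)
    (fun t ht x hx => eq_zero_of_betheMatrix_mulVec_eq_zero hC hW hCW hspec ht hx)
  simpa only [hone] using this

end Kernel

/-! ### Calculus of second derivatives. -/

section SecondDerivative

variable {E F : Type*} [NormedAddCommGroup E] [NormedSpace ℝ E] [NormedAddCommGroup F]
  [NormedSpace ℝ F]

/-- `f` has the second derivative `B` at `x`. -/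
def HasSecondFDerivAt (f : E → ℝ) (B : E →L[ℝ] E →L[ℝ] ℝ) (x : E) : Prop :=
  ∃ f' : E → E →L[ℝ] ℝ, (∀ᶠ y in 𝓝 x, HasFDerivAt f (f' y) y) ∧ HasFDerivAt f' B x

theorem HasSecondFDerivAt.fderiv_fderiv {f : E → ℝ} {B : E →L[ℝ] E →L[ℝ] ℝ} {x : E}
    (h : HasSecondFDerivAt f B x) : fderiv ℝ (fderiv ℝ f) x = B := by
  obtain ⟨f', h1, h2⟩ := h
  have heq : fderiv ℝ f =ᶠ[𝓝 x] f' := h1.mono fun y hy => hy.fderiv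
  rw [heq.fderiv_eq, h2.fderiv]

theorem hasSecondFDerivAt_of_contDiffAt {f : E → ℝ} {x : E} (h : ContDiffAt ℝ 2 f x) :
    HasSecondFDerivAt f (fderiv ℝ (fderiv ℝ f) x) x :=
  ⟨fderiv ℝ f, (h.eventually (by simp)).mono fun _ hy =>
    (hy.differentiableAt two_ne_zero).hasFDerivAt,
    ((h.fderiv_right (m := 1) (by norm_num)).differentiableAt one_ne_zero).hasFDerivAt⟩

theorem hasSecondFDerivAt_clm (l : E →L[ℝ] ℝ) (x : E) :
    HasSecondFDerivAt l 0 x :=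
  ⟨fun _ => l, Eventually.of_forall fun _ => l.hasFDerivAt, hasFDerivAt_const _ _⟩

theorem HasSecondFDerivAt.add {f g : E → ℝ} {B B' : E →L[ℝ] E →L[ℝ] ℝ} {x : E}
    (hf : HasSecondFDerivAt f B x) (hg : HasSecondFDerivAt g B' x) :
    HasSecondFDerivAt (fun y => f y + g y) (B + B') x := by
  obtain ⟨f', h1, h2⟩ := hf
  obtain ⟨g', h3, h4⟩ := hg
  exact ⟨fun y => f' y + g' y, (h1.and h3).mono fun y hy => hy.1.add hy.2, h2.add h4⟩

theorem HasSecondFDerivAt.const_mul {f : E → ℝ} {B : E →L[ℝ] E →L[ℝ] ℝ} {x : E}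
    (hf : HasSecondFDerivAt f B x) (c : ℝ) :
    HasSecondFDerivAt (fun y => c * f y) (c • B) x := by
  obtain ⟨f', h1, h2⟩ := hf
  exact ⟨fun y => c • f' y, h1.mono fun y hy => hy.const_mul c, h2.const_smul c⟩

theorem HasSecondFDerivAt.sum {ι : Type*} {s : Finset ι} {f : ι → E → ℝ}
    {B : ι → E →L[ℝ] E →L[ℝ] ℝ} {x : E} (h : ∀ i ∈ s, HasSecondFDerivAt (f i) (B i) x) :
    HasSecondFDerivAt (fun y => ∑ i ∈ s, f i y) (∑ i ∈ s, B i) x := by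
  classical
  induction s using Finset.induction_on with
  | empty => exact hasSecondFDerivAt_clm (0 : E →L[ℝ] ℝ) x
  | insert a s ha ih =>
    simp only [Finset.sum_insert ha]
    exact (h a (Finset.mem_insert_self a s)).add
      (ih fun i hi => h i (Finset.mem_insert_of_mem hi))

/-- The bilinear form `B` pulled back along `l`. -/
def pullbackForm (B : F →L[ℝ] F →L[ℝ] ℝ) (l : E →L[ℝ] F) : E →L[ℝ] E →L[ℝ] ℝ :=
  ((ContinuousLinearMap.compL ℝ E F ℝ).flip l).comp (B.comp l)

theorem pullbackForm_apply (B : F →L[ℝ] F →L[ℝ] ℝ) (l : E →L[ℝ] F) (v w : E) :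
    pullbackForm B l v w = B (l v) (l w) := rfl

theorem HasSecondFDerivAt.comp_clm {f : F → ℝ} {B : F →L[ℝ] F →L[ℝ] ℝ} {l : E →L[ℝ] F} {x : E}
    (hf : HasSecondFDerivAt f B (l x)) :
    HasSecondFDerivAt (fun y => f (l y)) (pullbackForm B l) x := by
  obtain ⟨f', h1, h2⟩ := hf
  refine ⟨fun y => (f' (l y)).comp l, ?_, ?_⟩
  · exact (l.continuous.continuousAt.eventually h1).mono fun y hy => hy.comp y l.hasFDerivAt
  · exact ((ContinuousLinearMap.compL ℝ E F ℝ).flip l).hasFDerivAt.comp x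
      (h2.comp x l.hasFDerivAt)

end SecondDerivative

/-- The continuous linear map `x ↦ x ∘ σ`. -/
def reindexCLM {m n : Type*} (σ : m → n) : (n → ℝ) →L[ℝ] (m → ℝ) :=
  ContinuousLinearMap.pi fun a => ContinuousLinearMap.proj (σ a)

theorem reindexCLM_apply {m n : Type*} (σ : m → n) (x : n → ℝ) : reindexCLM σ x = x ∘ σ := rfl

/-! ### The Hessian of the Bethe free energy. -/

namespace InferenceFamily

variable {V : Type*} [DecidableEq V] {H : Hypergraph V} {X : V → Type*}
  [∀ i, MeasurableSpace (X i)] (I : InferenceFamily H X)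

theorem measurable_φFactor (α : H.Factor) : Measurable (I.φFactor α) := by
  refine measurable_pi_iff.2 fun p => ?_
  rcases p with k | ⟨i, k⟩
  · exact (measurable_pi_apply k).comp (I.measurable_φF α)
  · exact (measurable_pi_apply k).comp ((I.measurable_φ i).comp (measurable_pi_apply i))

/-- The covariance matrix of the full statistic of `α` under the belief `b_α`. -/
def factorCov (η : I.Coord → ℝ) (α : H.Factor) :
    Matrix (FactorIndex I.r I.s α) (FactorIndex I.r I.s α) ℝ :=
  covMatrix (I.beliefFactor η α) (I.φFactor α) (I.φFactor α)

/-- The covariance matrix of the statistic of `i` under the belief `b_i`. -/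
def vertexCov (η : I.Coord → ℝ) (i : V) : Matrix (Fin (I.r i)) (Fin (I.r i)) ℝ :=
  covMatrix (I.beliefVertex η i) (I.φ i) (I.φ i)

variable {I}

/-- The marginal of the belief `b_α` at a vertex `i ∈ α` is the belief `b_i`. -/
theorem map_beliefFactor {η : I.Coord → ℝ} (hη : η ∈ I.L) (α : H.Factor)
    (i : {i : V // i ∈ α.1}) :
    (I.beliefFactor η α).map (fun x => x i) = I.beliefVertex η i := by
  obtain ⟨θ, hθ, hmean⟩ := hη.1 α
  obtain ⟨θ', hθ', hmap⟩ := I.marginally_closed α i θ hθ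
  have hb : I.beliefFactor η α = expDist (I.νFactor α) (I.φFactor α) θ := by
    rw [beliefFactor, ← hmean]
    exact distOfMean_expectationMap (I.measurable_φFactor α) (I.isUnit_hessian_factor α) hθ
  -- The marginal is a member of the family of `i` with mean `η_i`, and by injectivity of `Λ` the
  -- mean determines the member.
  have hmean' : expectationMap (I.ν i) (I.φ i) θ' = I.etaVertex η i := by
    ext k
    have h1 := congrFun hmean (Sum.inr ⟨i, k⟩)
    have hm : Measurable fun x => I.φ i x k := (measurable_pi_apply k).comp (I.measurable_φ i)
    rw [expectationMap, ← hmap, integral_map (measurable_pi_apply i).aemeasurable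
      hm.aestronglyMeasurable]
    exact h1
  rw [hb, hmap, beliefVertex, ← hmean']
  exact (distOfMean_expectationMap (I.measurable_φ i) (I.isUnit_hessian_vertex i) hθ').symm

/-- A covariance of functions of `x i` alone depends only on the marginal at `i`, which is `b_i`. -/
theorem factorCov_inr_inr {η : I.Coord → ℝ} (hη : η ∈ I.L) (α : H.Factor)
    (i : {i : V // i ∈ α.1}) (k l : Fin (I.r i)) :
    I.factorCov η α (Sum.inr ⟨i, k⟩) (Sum.inr ⟨i, l⟩) = I.vertexCov η i k l := by
  have hm : ∀ k, Measurable fun x => I.φ i x k := fun k =>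
    (measurable_pi_apply k).comp (I.measurable_φ i)
  rw [vertexCov, covMatrix, Matrix.of_apply, ← map_beliefFactor hη α i, covariance_map
    (hm k).aestronglyMeasurable (hm l).aestronglyMeasurable (measurable_pi_apply i).aemeasurable]
  rfl

theorem posDef_factorCov {η : I.Coord → ℝ} (hη : η ∈ I.L) (α : H.Factor) :
    (I.factorCov η α).PosDef :=
  posDef_covMatrix_distOfMean (I.measurable_φFactor α) (I.isUnit_hessian_factor α) (hη.1 α)

theorem posDef_vertexCov {η : I.Coord → ℝ} (hη : η ∈ I.L) (i : V) :
    (I.vertexCov η i).PosDef :=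
  posDef_covMatrix_distOfMean (I.measurable_φ i) (I.isUnit_hessian_vertex i) (hη.2 i)

variable (I) in
theorem etaFactor_eq (η : I.Coord → ℝ) (α : H.Factor) :
    I.etaFactor η α = reindexCLM (factorEmb I.r I.s α) η := by
  ext p
  rcases p with k | ⟨i, k⟩ <;> rfl

variable [Fintype V]

/-- Every term becomes a function of a linear image of `η`, so that the chain rule turns its Hessian
into a pulled back form. -/
theorem betheFreeEnergy_eq (θbar : ∀ α : H.Factor, I.FactorIdx α → ℝ) :
    I.betheFreeEnergy θbar = fun η =>
      (-∑ α, (dotCLM (θbar α)).comp (reindexCLM (factorEmb I.r I.s α))) η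
        + ∑ α : H.Factor, legendre (I.νFactor α) (I.φFactor α) (reindexCLM (factorEmb I.r I.s α) η)
        + ∑ i : V, (1 - (H.degree i : ℝ)) *
          legendre (I.ν i) (I.φ i) (reindexCLM (vertexEmb I.r I.s i) η) := by
  have hver : ∀ η i, I.etaVertex η i = reindexCLM (vertexEmb I.r I.s i) η := fun η i => rfl
  ext η
  simp only [betheFreeEnergy, etaFactor_eq, hver, neg_apply, sum_apply, ContinuousLinearMap.comp_apply,
    dotCLM_apply, dotProduct_comm]

theorem contDiffAt_betheFreeEnergy (θbar : ∀ α : H.Factor, I.FactorIdx α → ℝ) {η : I.Coord → ℝ}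
    (hη : η ∈ I.L) : ContDiffAt ℝ 2 (I.betheFreeEnergy θbar) η := by
  have hfac : ∀ α, I.etaFactor η α = reindexCLM (factorEmb I.r I.s α) η := I.etaFactor_eq η
  rw [betheFreeEnergy_eq]
  refine ContDiffAt.add (ContDiffAt.add (ContinuousLinearMap.contDiff _).contDiffAt ?_) ?_
  · refine ContDiffAt.sum fun α _ => ?_
    refine ContDiffAt.comp (g := legendre (I.νFactor α) (I.φFactor α)) η ?_
      (reindexCLM (factorEmb I.r I.s α)).contDiff.contDiffAt
    exact contDiffAt_legendre (I.measurable_φFactor α) (I.isUnit_hessian_factor α)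
      (hfac α ▸ hη.1 α)
  · refine ContDiffAt.sum fun i _ => contDiffAt_const.mul ?_
    refine ContDiffAt.comp (g := legendre (I.ν i) (I.φ i)) η ?_
      (reindexCLM (vertexEmb I.r I.s i)).contDiff.contDiffAt
    exact contDiffAt_legendre (I.measurable_φ i) (I.isUnit_hessian_vertex i) (hη.2 i)

theorem hessian_betheFreeEnergy (θbar : ∀ α : H.Factor, I.FactorIdx α → ℝ) {η : I.Coord → ℝ}
    (hη : η ∈ I.L) : hessian (I.betheFreeEnergy θbar) η =
      betheMatrix (I.factorCov η) (I.vertexCov η) := by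
  have hfac : ∀ α, I.etaFactor η α = reindexCLM (factorEmb I.r I.s α) η := I.etaFactor_eq η
  have hlegF : ∀ α, HasSecondFDerivAt
      (fun η => legendre (I.νFactor α) (I.φFactor α) (reindexCLM (factorEmb I.r I.s α) η))
      (pullbackForm (fderiv ℝ (fderiv ℝ (legendre (I.νFactor α) (I.φFactor α)))
        (I.etaFactor η α)) (reindexCLM (factorEmb I.r I.s α))) η := fun α => by
    rw [hfac]
    exact (hasSecondFDerivAt_of_contDiffAt (contDiffAt_legendre (I.measurable_φFactor α)
      (I.isUnit_hessian_factor α) (hfac α ▸ hη.1 α))).comp_clm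
  have hlegV : ∀ i, HasSecondFDerivAt
      (fun η => legendre (I.ν i) (I.φ i) (reindexCLM (vertexEmb I.r I.s i) η))
      (pullbackForm (fderiv ℝ (fderiv ℝ (legendre (I.ν i) (I.φ i)))
        (I.etaVertex η i)) (reindexCLM (vertexEmb I.r I.s i))) η := fun i =>
    (hasSecondFDerivAt_of_contDiffAt (contDiffAt_legendre (I.measurable_φ i)
      (I.isUnit_hessian_vertex i) (hη.2 i))).comp_clm (l := reindexCLM (vertexEmb I.r I.s i))
  have h := ((hasSecondFDerivAt_clm
    (-∑ α, (dotCLM (θbar α)).comp (reindexCLM (factorEmb I.r I.s α))) η).add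
      (HasSecondFDerivAt.sum (s := Finset.univ) fun α _ => hlegF α)).add
      (HasSecondFDerivAt.sum (s := Finset.univ) fun i _ =>
        (hlegV i).const_mul (1 - (H.degree i : ℝ)))
  ext a b
  have hentry : betheMatrix (I.factorCov η) (I.vertexCov η) a b = Pi.single a 1 ⬝ᵥ
      betheMatrix (I.factorCov η) (I.vertexCov η) *ᵥ Pi.single b 1 := by
    simp
  rw [hessian, Matrix.of_apply, betheFreeEnergy_eq, h.fderiv_fderiv, hentry,
    dotProduct_betheMatrix_mulVec]
  simp only [add_apply, sum_apply, smul_apply, zero_apply, zero_add, pullbackForm_apply,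
    reindexCLM_apply, smul_eq_mul]
  congr 1
  · exact Finset.sum_congr rfl fun α _ => fderiv_fderiv_legendre (I.measurable_φFactor α)
      (I.isUnit_hessian_factor α) (hη.1 α) _ _
  · exact Finset.sum_congr rfl fun i _ => congrArg _ (fderiv_fderiv_legendre (I.measurable_φ i)
      (I.isUnit_hessian_vertex i) (hη.2 i) _ _)

end InferenceFamily

end Bethe

end

theorem theorem5 {V : Type*} [Fintype V] [DecidableEq V] {H : Bethe.Hypergraph V}
    {X : V → Type*} [∀ i, MeasurableSpace (X i)] (I : Bethe.InferenceFamily H X)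
    (θbar : ∀ α : H.Factor, I.FactorIdx α → ℝ) (η : I.Coord → ℝ) (hη : η ∈ I.L)
    (hspec : ∀ z : ℂ,
      Module.End.HasEigenvalue (Matrix.toLin'
        (Bethe.edgeMatrix fun α i j => (I.weight η α i j).map (fun t : ℝ => (t : ℂ)))) z →
      ¬ ∃ t : ℝ, 1 ≤ t ∧ z = (t : ℂ)) :
    ContDiffAt ℝ 2 (I.betheFreeEnergy θbar) η ∧
      (Bethe.hessian (I.betheFreeEnergy θbar) η).PosDef := by
  refine ⟨Bethe.InferenceFamily.contDiffAt_betheFreeEnergy θbar hη, ?_⟩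
  rw [Bethe.InferenceFamily.hessian_betheFreeEnergy θbar hη]
  -- The weights of `I` unfold to `covWeight` of these covariances, so `hspec` applies as it stands.
  exact Bethe.posDef_betheMatrix (Bethe.InferenceFamily.posDef_factorCov hη)
    (Bethe.InferenceFamily.posDef_vertexCov hη)
    (Bethe.InferenceFamily.factorCov_inr_inr hη) hspec
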